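/- Let $\alpha\in(0,1)$ with $\alpha\neq 1/n$ for all $n\in\mathbb N$, and let $N=\lfloor\alpha^{-1}\rfloor$. For a finite label set $A$, let $\mathcal H$ be the Connes--Kreimer Hopf algebra: the polynomial algebra over the rooted trees with nodes labelled by $A$, with the set $\mathcal F$ of forests as linear basis, graded by the number of nodes $|h|$, with the grafting maps $[\cdot]_a$, $a\in A$ ($[h]_a$ joins all the trees of $h$ to a new root labelled $a$), and with the multiplicative coproduct $\Delta$ determined by $\Delta\mathbf 1=\mathbf 1\otimes\mathbf 1$ and $\Delta[h]_a=(\mathrm{id}\otimes[\cdot]_a)\Delta h+[h]_a\otimes\mathbf 1$. For linear functionals put $\phi\star\psi=m_{\mathbb R}\circ(\phi\otimes\psi)\circ\Delta$, and identify a forest $h$ with the functional $\langle h,\cdot\rangle$ that is $1$ on $h$ and $0$ on the other forests. For $f\colon[0,T]^2\to\mathbb R$ and $\gamma>0$ let $\|f\|_\gamma=\sup_{s\ne t}|f_{s,t}|/|t-s|^\gamma$. An $\alpha$-Hölder branched rough path on $[0,T]$ is a family of characters $(\mathbf X_{s,t})_{s,t\in[0,T]}$ of $\mathcal H$ with $|\mathbf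 X^h_{s,t}|\lesssim|t-s|^{\alpha|h|}$ for every forest $h$, where $\mathbf X^h_{s,t}=\langle\mathbf X_{s,t},h\rangle$, and $\mathbf X_{s,u}\star\mathbf X_{u,t}=\mathbf X_{s,t}$ for all $s,u,t\in[0,T]$. Put $\|\mathbf X\|_\alpha=\max_{1\le|h|\le N}\|\mathbf X^h\|_{|h|\alpha}$. The space $\mathscr D^\alpha_{\mathbf X}$ of paths controlled by $\mathbf X$ consists of the paths $\mathbf Z\colon[0,T]\to\mathrm{span}\{h\in\mathcal F:|h|<N\}$ such that, for every forest $h$ with $|h|<N$, the remainder $$R^h_{s,t}=\langle h,\mathbf Z_t\rangle-\langle\mathbf X_{s,t}\star h,\mathbf Z_s\rangle$$ satisfies $|R^h_{s,t}|\lesssim|t-s|^{(N-|h|)\alpha}$; its norm is $$\|\mathbf Z\|_\alpha=\sum_{|h|<N}\bigl(|\langle h,\mathbf Z_0\rangle|+\|R^h\|_{(N-|h|)\alpha}\bigr).$$ Then there is a constant $C=C(\alpha)$ such that for every finite label set $A$, every $T>0$, every $\alpha$-Hölder branched rough path $\mathbf X$ on $[0,T]$, every label $a\in A$ and every $\mathbf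 Z\in\mathscr D^\alpha_{\mathbf X}$ the following holds. The rough integral $$\int_0^tZ_s\,\mathrm d\mathbf X^a_s=\lim_{|\pi|\to0}\sum_{[u,v]\in\pi}\ \sum_{|h|<N}\langle h,\mathbf Z_u\rangle\,\mathbf X^{[h]_a}_{u,v}\qquad(\pi\text{ a partition of }[0,t])$$ exists for every $t\in[0,T]$; the path $\mathfrak I^a_{\mathbf X}(\mathbf Z)$ with components $\langle\mathbf 1,\mathfrak I^a_{\mathbf X}(\mathbf Z)_t\rangle=\int_0^tZ_s\,\mathrm d\mathbf X^a_s$, $\langle[h]_a,\mathfrak I^a_{\mathbf X}(\mathbf Z)_t\rangle=\langle h,\mathbf Z_t\rangle$ for the forests $h$ with $|h|+1<N$, and zero otherwise, belongs to $\mathscr D^\alpha_{\mathbf X}$; and $$\|\mathfrak I^a_{\mathbf X}(\mathbf Z)\|_\alpha\le C\,(1+T^\alpha)\,(1+\|\mathbf X\|_\alpha)\,\|\mathbf Z\|_\alpha .$$ -/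

import Mathlib

open scoped TensorProduct
open Filter Topology

namespace BranchedRP

/-- Planar forests of rooted trees whose nodes carry labels in `A`. `nil` is the empty forest;
`cons a h k` is the forest whose first tree has root label `a` and branches `h` (grafted to that
root), followed by the forest `k`. -/
inductive PlanarForest (A : Type*) : Type _
  | nil : PlanarForest A
  | cons (a : A) (branches rest : PlanarForest A) : PlanarForest A

namespace PlanarForest

variable {A : Type*}

/-- Two planar forests are isomorphic as (non-planar) labelled forests: one is obtained from the
other by permuting the trees of the forest and the branches at every node. -/
inductive Iso : PlanarForest A → PlanarForest A → Prop
  | refl (h : PlanarForest A) : Iso h h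
  | symm {h k : PlanarForest A} : Iso h k → Iso k h
  | trans {h k l : PlanarForest A} : Iso h k → Iso k l → Iso h l
  | cons (a : A) {h h' k k' : PlanarForest A} :
      Iso h h' → Iso k k' → Iso (cons a h k) (cons a h' k')
  | swap (a b : A) (h g k : PlanarForest A) :
      Iso (cons a h (cons b g k)) (cons b g (cons a h k))

instance setoid (A : Type*) : Setoid (PlanarForest A) where
  r := Iso
  iseqv := ⟨Iso.refl, Iso.symm, Iso.trans⟩

/-- Number of nodes. -/
def degree : PlanarForest A → ℕ
  | nil => 0
  | cons _ h k => degree h + 1 + degree k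

/-- Juxtaposition of planar forests. -/
def append : PlanarForest A → PlanarForest A → PlanarForest A
  | nil, l => l
  | cons a h k, l => cons a h (append k l)

theorem Iso.degree_eq {h k : PlanarForest A} (e : Iso h k) : h.degree = k.degree := by
  induction e with
  | refl => rfl
  | symm _ ih => exact ih.symm
  | trans _ _ ih₁ ih₂ => exact ih₁.trans ih₂
  | cons a _ _ ih₁ ih₂ => simp [degree, ih₁, ih₂]
  | swap a b h g k => simp only [degree]; omega

theorem append_nil (h : PlanarForest A) : append h nil = h := by
  induction h with
  | nil => rfl
  | cons a h k _ ih => simp [append, ih]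

theorem append_assoc (h k l : PlanarForest A) :
    append (append h k) l = append h (append k l) := by
  induction h with
  | nil => rfl
  | cons a h k _ ih => simp [append, ih]

theorem Iso.append_right {h h' : PlanarForest A} (e : Iso h h') (l : PlanarForest A) :
    Iso (append h l) (append h' l) := by
  induction e with
  | refl => exact Iso.refl _
  | symm _ ih => exact ih.symm
  | trans _ _ ih₁ ih₂ => exact ih₁.trans ih₂
  | cons a e₁ _ _ ih₂ => exact Iso.cons a e₁ ih₂
  | swap a b h g k => exact Iso.swap a b h g _

theorem Iso.append_left (l : PlanarForest A) {h h' : PlanarForest A} (e : Iso h h') :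
    Iso (append l h) (append l h') := by
  induction l with
  | nil => exact e
  | cons a g k _ ih => exact Iso.cons a (Iso.refl g) ih

theorem append_cons_iso (h : PlanarForest A) (a : A) (g k : PlanarForest A) :
    Iso (append h (cons a g k)) (cons a g (append h k)) := by
  induction h with
  | nil => exact Iso.refl _
  | cons b h l _ ih => exact (Iso.cons b (Iso.refl h) ih).trans (Iso.swap _ _ _ _ _)

theorem append_comm_iso (h k : PlanarForest A) : Iso (append h k) (append k h) := by
  induction k with
  | nil => rw [append_nil]; exact Iso.refl _
  | cons a g k _ ih => exact (append_cons_iso h a g k).trans (Iso.cons a (Iso.refl g) ih)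

theorem degree_append (h k : PlanarForest A) :
    (append h k).degree = h.degree + k.degree := by
  induction h with
  | nil => simp [append, degree]
  | cons a h l _ ih => simp only [append, degree, ih]; omega

theorem finite_degree_lt [Finite A] (n : ℕ) : {h : PlanarForest A | h.degree < n}.Finite := by
  induction n with
  | zero => simp
  | succ n ih =>
    have key : {h : PlanarForest A | h.degree < n + 1} ⊆
        {nil} ∪ (fun p : A × PlanarForest A × PlanarForest A => cons p.1 p.2.1 p.2.2) ''
          (Set.univ ×ˢ ({h | h.degree < n} ×ˢ {h | h.degree < n})) := by
      intro h hh
      cases h with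
      | nil => exact Or.inl rfl
      | cons a h k =>
        change h.degree + 1 + k.degree < n + 1 at hh
        refine Or.inr ⟨(a, h, k), ⟨Set.mem_univ _, ?_, ?_⟩, rfl⟩
        · show h.degree < n
          omega
        · show k.degree < n
          omega
    exact ((Set.finite_singleton _).union
      ((Set.finite_univ.prod (ih.prod ih)).image _)).subset key

end PlanarForest

/-- The set `𝓕` of (non-planar) forests of rooted trees with node labels in `A`. -/
def Forest (A : Type*) : Type _ := Quotient (PlanarForest.setoid A)

namespace Forest

variable {A : Type*}

/-- The forest underlying a planar forest. -/
def mk (h : PlanarForest A) : Forest A := Quotient.mk _ h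

/-- The unit is the empty forest, the product is the disjoint union. -/
instance : CommMonoid (Forest A) where
  one := mk PlanarForest.nil
  mul := Quotient.map₂ PlanarForest.append
    fun _ _ e₁ _ _ e₂ => (e₁.append_right _).trans (e₂.append_left _)
  one_mul := by
    rintro ⟨h⟩
    rfl
  mul_one := by
    rintro ⟨h⟩
    exact congrArg mk (PlanarForest.append_nil h)
  mul_assoc := by
    rintro ⟨h⟩ ⟨k⟩ ⟨l⟩
    exact congrArg mk (PlanarForest.append_assoc h k l)
  mul_comm := by
    rintro ⟨h⟩ ⟨k⟩
    exact Quotient.sound (PlanarForest.append_comm_iso h k)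

/-- The degree `|h|`: the number of nodes. -/
def degree : Forest A → ℕ := Quotient.lift PlanarForest.degree fun _ _ e => e.degree_eq

/-- The tree `[h]_a`: all the trees of `h` are grafted to a new root with label `a`. -/
def graft (a : A) : Forest A → Forest A :=
  Quotient.map (fun h => PlanarForest.cons a h PlanarForest.nil)
    fun _ _ e => PlanarForest.Iso.cons a e (PlanarForest.Iso.refl _)

theorem finite_degree_lt [Finite A] (n : ℕ) : {h : Forest A | h.degree < n}.Finite := by
  refine ((PlanarForest.finite_degree_lt (A := A) n).image mk).subset ?_
  rintro ⟨h⟩ hh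
  exact ⟨h, hh, rfl⟩

end Forest

noncomputable section

variable {A : Type*}

/-- The finite set of forests with fewer than `n` nodes. -/
def forestsLT (A : Type*) [Finite A] (n : ℕ) : Finset (Forest A) :=
  (Forest.finite_degree_lt (A := A) n).toFinset

/-- The Connes–Kreimer algebra `𝓗`: the vector space spanned by the forests, with the product that
extends the disjoint union, that is, the polynomial algebra over the trees. -/
abbrev CK (A : Type*) : Type _ := MonoidAlgebra ℝ (Forest A)

/-- A forest as a basis element of `𝓗`. -/
def CK.ofForest (h : Forest A) : CK A := MonoidAlgebra.of ℝ (Forest A) h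

/-- The linear map `[·]_a : 𝓗 → 𝓗`. -/
def CK.graft (a : A) : CK A →ₗ[ℝ] CK A := MonoidAlgebra.mapDomainLinearMap ℝ ℝ (Forest.graft a)

/-- The coproduct on forests, by `Δ 1 = 1 ⊗ 1`, multiplicativity and
`Δ [h]_a = (id ⊗ [·]_a) Δ h + [h]_a ⊗ 1`. -/
def PlanarForest.comul : PlanarForest A → CK A ⊗[ℝ] CK A
  | .nil => 1
  | .cons a h k =>
      ((CK.graft a).lTensor (CK A) (comul h) +
        CK.ofForest (Forest.graft a (Forest.mk h)) ⊗ₜ[ℝ] 1) * comul k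

theorem PlanarForest.Iso.comul_eq {h k : PlanarForest A} (e : Iso h k) :
    h.comul = k.comul := by
  induction e with
  | refl => rfl
  | symm _ ih => exact ih.symm
  | trans _ _ ih₁ ih₂ => exact ih₁.trans ih₂
  | @cons a h h' k k' e₁ _ ih₁ ih₂ =>
    have : Forest.mk h = Forest.mk h' := Quotient.sound e₁
    simp only [comul, ih₁, ih₂, this]
  | swap a b h g k =>
    simp only [comul]
    exact mul_left_comm _ _ _

theorem PlanarForest.comul_append (h k : PlanarForest A) :
    (append h k).comul = h.comul * k.comul := by
  induction h with
  | nil => exact (one_mul _).symm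
  | cons a h l _ ih =>
    simp only [append, comul, ih]
    exact (mul_assoc _ _ _).symm

/-- The coproduct on forests, as a monoid homomorphism. -/
def Forest.comul : Forest A →* CK A ⊗[ℝ] CK A where
  toFun := Quotient.lift PlanarForest.comul fun _ _ e => e.comul_eq
  map_one' := rfl
  map_mul' := by
    rintro ⟨h⟩ ⟨k⟩
    exact PlanarForest.comul_append h k

/-- The coproduct `Δ : 𝓗 → 𝓗 ⊗ 𝓗`. -/
def CK.comul : CK A →ₐ[ℝ] CK A ⊗[ℝ] CK A :=
  MonoidAlgebra.lift ℝ (CK A ⊗[ℝ] CK A) (Forest A) Forest.comul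

/-- The convolution product `φ ⋆ ψ = m ∘ (φ ⊗ ψ) ∘ Δ` of linear functionals on `𝓗`. -/
def convolution (φ ψ : CK A →ₗ[ℝ] ℝ) : CK A →ₗ[ℝ] ℝ :=
  LinearMap.mul' ℝ ℝ ∘ₗ TensorProduct.map φ ψ ∘ₗ CK.comul.toLinearMap

/-- A forest `h` as an element of the dual of `𝓗`: the functional which is `1` on `h` and `0` on
the other forests. -/
def dualForest (h : Forest A) : CK A →ₗ[ℝ] ℝ :=
  Finsupp.lapply h ∘ₗ (MonoidAlgebra.coeffLinearEquiv ℝ).toLinearMap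

/-- The time interval `[0, T]`. -/
abbrev Time (T : ℝ) : Type := Set.Icc (0 : ℝ) T

/-- The initial time. -/
def Time.zero {T : ℝ} (hT : 0 < T) : Time T := ⟨0, le_rfl, hT.le⟩

/-- The seminorm `‖f‖_γ = sup_{s ≠ t} |f_{s,t}| / |t - s| ^ γ`; a supremum of real numbers, to be
used for `f` for which it is finite. -/
def holderNorm {T : ℝ} (γ : ℝ) (f : Time T → Time T → ℝ) : ℝ :=
  ⨆ p : {p : Time T × Time T // p.1 ≠ p.2},
    |f p.1.1 p.1.2| / |(p.1.2 : ℝ) - (p.1.1 : ℝ)| ^ γ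

/-- An `α`-Hölder branched rough path on `[0, T]`: a family of characters of `𝓗`. -/
structure BranchedRoughPath (A : Type*) (α T : ℝ) where
  /-- The character `X_{s,t}`. -/
  toFun : Time T → Time T → (CK A →ₐ[ℝ] ℝ)
  holder : ∀ h : Forest A, ∃ K : ℝ, ∀ s t : Time T,
    |toFun s t (CK.ofForest h)| ≤ K * |(t : ℝ) - (s : ℝ)| ^ (α * h.degree)
  chen : ∀ s u t : Time T,
    convolution (toFun s u).toLinearMap (toFun u t).toLinearMap = (toFun s t).toLinearMap

/-- The order `N = ⌊1 / α⌋`. -/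
def order (α : ℝ) : ℕ := ⌊α⁻¹⌋₊

variable {α T : ℝ}

namespace BranchedRoughPath

/-- The component `X^h_{s,t}`. -/
def component (X : BranchedRoughPath A α T) (h : Forest A) (s t : Time T) : ℝ :=
  X.toFun s t (CK.ofForest h)

/-- `‖X‖_α`: the maximum of `‖X^h‖_{α|h|}` over the forests `h` with `1 ≤ |h| ≤ N`. -/
def norm (X : BranchedRoughPath A α T) : ℝ :=
  ⨆ h : {h : Forest A // 1 ≤ h.degree ∧ h.degree ≤ order α},
    holderNorm (h.1.degree * α) (X.component h.1)

/-- `R^h_{s,t} = ⟨h, Z_t⟩ - ⟨X_{s,t} ⋆ h, Z_s⟩`. -/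
def remainder (X : BranchedRoughPath A α T) (Z : Time T → CK A) (h : Forest A)
    (s t : Time T) : ℝ :=
  dualForest h (Z t) - convolution (X.toFun s t).toLinearMap (dualForest h) (Z s)

/-- The space `𝓓^α_X` of the paths controlled by `X`: the paths with values in the span of the
forests with fewer than `N` nodes, with `|R^h_{s,t}| ≲ |t - s| ^ ((N - |h|) α)` for these `h`. -/
def controlledPaths (X : BranchedRoughPath A α T) : Submodule ℝ (Time T → CK A) where
  carrier := {Z |
    (∀ t, Z t ∈ Submodule.span ℝ
      (CK.ofForest '' {h : Forest A | h.degree < order α})) ∧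
    ∀ h : Forest A, h.degree < order α → ∃ K : ℝ, ∀ s t : Time T,
      |X.remainder Z h s t| ≤
        K * |(t : ℝ) - (s : ℝ)| ^ (((order α : ℝ) - (h.degree : ℝ)) * α)}
  zero_mem' := ⟨fun _ => Submodule.zero_mem _, fun h _ => ⟨0, fun s t => by
    simp [remainder]⟩⟩
  add_mem' := by
    rintro Z W ⟨hZ, hZ'⟩ ⟨hW, hW'⟩
    refine ⟨fun t => Submodule.add_mem _ (hZ t) (hW t), fun h hh => ?_⟩
    obtain ⟨K, hK⟩ := hZ' h hh
    obtain ⟨L, hL⟩ := hW' h hh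
    refine ⟨K + L, fun s t => ?_⟩
    have e : X.remainder (Z + W) h s t = X.remainder Z h s t + X.remainder W h s t := by
      simp only [remainder, Pi.add_apply, map_add]
      ring
    rw [e, add_mul]
    exact (abs_add_le _ _).trans (add_le_add (hK s t) (hL s t))
  smul_mem' := by
    rintro c Z ⟨hZ, hZ'⟩
    refine ⟨fun t => Submodule.smul_mem _ c (hZ t), fun h hh => ?_⟩
    obtain ⟨K, hK⟩ := hZ' h hh
    refine ⟨|c| * K, fun s t => ?_⟩
    have e : X.remainder (c • Z) h s t = c * X.remainder Z h s t := by
      simp only [remainder, Pi.smul_apply, map_smul, smul_eq_mul]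
      ring
    rw [e, abs_mul, mul_assoc]
    exact mul_le_mul_of_nonneg_left (hK s t) (abs_nonneg c)

/-- `‖Z‖_α = ∑_{|h| < N} (|⟨h, Z_0⟩| + ‖R^h‖_{(N - |h|) α})`. -/
def controlledNorm [Finite A] (X : BranchedRoughPath A α T) (hT : 0 < T)
    (Z : Time T → CK A) : ℝ :=
  ∑ h ∈ forestsLT A (order α),
    (|dualForest h (Z (Time.zero hT))| +
      holderNorm (((order α : ℝ) - (h.degree : ℝ)) * α) (X.remainder Z h))

end BranchedRoughPath

/-- A partition `s = τ_0 ≤ τ_1 ≤ ⋯ ≤ τ_n = t` of `[s, t]`. -/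
structure IntervalPartition (s t : Time T) where
  /-- The number of intervals. -/
  size : ℕ
  /-- The points. -/
  point : Fin (size + 1) → Time T
  mono : Monotone point
  first : point 0 = s
  last : point (Fin.last size) = t

/-- The mesh `|π|`: the largest length of an interval of `π`. -/
def IntervalPartition.mesh {s t : Time T} (π : IntervalPartition s t) : ℝ :=
  ⨆ i : Fin π.size, ((π.point i.succ : ℝ) - (π.point i.castSucc : ℝ))

/-- The filter `|π| → 0` on the partitions of `[s, t]`. -/
def meshToZero (s t : Time T) : Filter (IntervalPartition s t) :=
  comap IntervalPartition.mesh (𝓝 0)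

namespace BranchedRoughPath

/-- The compensated Riemann sum
`∑_{[u,v] ∈ π} ∑_{|h| < N} ⟨h, Z_u⟩ X^{[h]_a}_{u,v}`. -/
def riemannSum [Finite A] (X : BranchedRoughPath A α T) (a : A) (Z : Time T → CK A)
    {s t : Time T} (π : IntervalPartition s t) : ℝ :=
  ∑ i : Fin π.size, ∑ h ∈ forestsLT A (order α),
    dualForest h (Z (π.point i.castSucc)) *
      X.component (h.graft a) (π.point i.castSucc) (π.point i.succ)

/-- The rough integral `∫_0^t Z_s dX^a_s`: the limit of the Riemann sums as `|π| → 0`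
(an arbitrary number if there is no limit). -/
def roughIntegral [Finite A] (X : BranchedRoughPath A α T) (hT : 0 < T) (a : A)
    (Z : Time T → CK A) (t : Time T) : ℝ :=
  limUnder (meshToZero (Time.zero hT) t) (X.riemannSum a Z)

/-- The rough integration map `𝔍^a_X`. The path `𝔍^a_X(Z)` has at time `t` the components
`∫_0^t Z_s dX^a_s` along the empty forest, `⟨h, Z_t⟩` along the trees `[h]_a` with fewer than `N`
nodes, and `0` along all other forests. -/
def integrationMap [Finite A] (X : BranchedRoughPath A α T) (hT : 0 < T) (a : A)
    (Z : Time T → CK A) (t : Time T) : CK A :=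
  X.roughIntegral hT a Z t • CK.ofForest 1 +
    ∑ h ∈ (forestsLT A (order α)).filter (fun h => h.degree + 1 < order α),
      dualForest h (Z t) • CK.ofForest (h.graft a)

end BranchedRoughPath

end

end BranchedRP

/-!
The rough integral is obtained by sewing the germ `Ξ_{s,t} = X_{s,t} [Z_s]_a`, where `X_{s,t}` acts
as a character and `[·]_a` as a linear map on `𝓗` (`sum_component_eq`). By Chen's relation and the
recursion `Δ [h]_a = (id ⊗ [·]_a) Δ h + [h]_a ⊗ 1`,
`Ξ_{s,t} - Ξ_{s,u} - Ξ_{u,t} = - ∑_{|h| < N} X^{[h]_a}_{u,t} R^h_{s,u}` (`germ_defect`). This is of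
order `(N + 1) α > 1`, so `exists_sewing` gives a path whose increments agree with `Ξ` to this
order, and `tendsto_sum_of_abs_increment_sub_le` identifies it as the limit of the Riemann sums.

Write `Z = Z' + Z''`, where `Z''` is the part of degree `N - 1` (`topPart`). The integral is the
path `∫ Z dX^a · 1 + [Z']_a`, so that its remainders can be computed from the same recursion:
* along `1`, the remainder is the sewing error plus `X_{s,t} [Z''_s]_a`;
* along `[h]_a`, it is `R^h_{s,t} + ⟨X_{s,t} ⋆ h, Z''_s⟩`;
* along all other forests it vanishes.

The increments of the components of `Z''` are remainders of `Z`, so these components are bounded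
uniformly in time (`topBound`). The number of forests grows with the number of labels, and the
constant must not. The coproduct of a forest `g` has at most `2 ^ |g|` terms for every set of labels
(`exists_comul_eq_sum`), and each sum over trunks `h` that occurs is a sum of cut counts of a fixed
forest (`sum_cutCount_le`). The remaining sums over forests are those in the norm of `Z`.
-/

open scoped TensorProduct
open Filter Topology

namespace BranchedRP

/-! ### Grafting, the coproduct and admissible cuts -/

section Algebra

variable {A : Type*}

theorem dualForest_ofForest [DecidableEq (Forest A)] (h g : Forest A) :
    dualForest h (CK.ofForest g) = if g = h then 1 else 0 := by
  simp [dualForest, CK.ofForest, MonoidAlgebra.of, Finsupp.single_apply]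

theorem CK.graft_ofForest (a : A) (g : Forest A) :
    CK.graft a (CK.ofForest g) = CK.ofForest (g.graft a) := by
  simp [CK.graft, CK.ofForest]

theorem CK.comul_ofForest (g : Forest A) : CK.comul (CK.ofForest g) = Forest.comul g := by
  simp [CK.comul, CK.ofForest]

theorem CK.ofForest_one : CK.ofForest (1 : Forest A) = 1 := map_one _

/-- Linear maps on `𝓗` that agree on forests are equal. -/
theorem CK.ext_forest {M : Type*} [AddCommMonoid M] [Module ℝ M] {f g : CK A →ₗ[ℝ] M}
    (h : ∀ k, f (CK.ofForest k) = g (CK.ofForest k)) : f = g := by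
  ext k
  exact h k

/-- The recursion for the coproduct, on all of `𝓗` instead of only on forests. -/
theorem CK.comul_graft (a : A) (z : CK A) :
    CK.comul (CK.graft a z) = (CK.graft a).lTensor (CK A) (CK.comul z) + CK.graft a z ⊗ₜ[ℝ] 1 := by
  have : CK.comul.toLinearMap ∘ₗ CK.graft a =
      (CK.graft a).lTensor (CK A) ∘ₗ CK.comul.toLinearMap +
        (TensorProduct.mk ℝ (CK A) (CK A)).flip 1 ∘ₗ CK.graft a := by
    refine CK.ext_forest ?_
    rintro ⟨k⟩
    change CK.comul (CK.graft a (CK.ofForest (Forest.mk k))) =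
      (CK.graft a).lTensor (CK A) (CK.comul (CK.ofForest (Forest.mk k))) +
        CK.graft a (CK.ofForest (Forest.mk k)) ⊗ₜ[ℝ] 1
    rw [CK.graft_ofForest, CK.comul_ofForest, CK.comul_ofForest]
    exact mul_one _
  exact LinearMap.congr_fun this z

theorem convolution_graft (φ ψ : CK A →ₗ[ℝ] ℝ) (a : A) (z : CK A) :
    convolution φ ψ (CK.graft a z) =
      convolution φ (ψ ∘ₗ CK.graft a) z + φ (CK.graft a z) * ψ 1 := by
  simp only [convolution, LinearMap.comp_apply, AlgHom.toLinearMap_apply, CK.comul_graft, map_add]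
  congr 1
  rw [← LinearMap.comp_apply (TensorProduct.map φ ψ), LinearMap.lTensor, ← TensorProduct.map_comp,
    LinearMap.comp_id]

/-- The forest obtained by deleting all roots. It is a left inverse of grafting, hence grafting is
injective. -/
def PlanarForest.pruned : PlanarForest A → Forest A
  | .nil => 1
  | .cons _ h k => Forest.mk h * pruned k

theorem PlanarForest.Iso.pruned_eq {h k : PlanarForest A} (e : Iso h k) : h.pruned = k.pruned := by
  induction e with
  | refl => rfl
  | symm _ ih => exact ih.symm
  | trans _ _ ih₁ ih₂ => exact ih₁.trans ih₂
  | cons a e₁ _ _ ih₂ =>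
    simp only [pruned, ih₂]
    rw [show Forest.mk _ = Forest.mk _ from Quotient.sound e₁]
  | swap a b h g k => exact mul_left_comm _ _ _

theorem Forest.graft_injective (a : A) : Function.Injective (Forest.graft a) := by
  rintro ⟨h⟩ ⟨k⟩ e
  have := (Quotient.exact e).pruned_eq
  simp only [PlanarForest.pruned, mul_one] at this
  exact this

theorem Forest.degree_graft (a : A) (h : Forest A) : (h.graft a).degree = h.degree + 1 := by
  obtain ⟨h⟩ := h
  rfl

theorem Forest.degree_one : (1 : Forest A).degree = 0 := rfl

theorem Forest.degree_mul (h k : Forest A) : (h * k).degree = h.degree + k.degree := by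
  obtain ⟨h⟩ := h
  obtain ⟨k⟩ := k
  exact PlanarForest.degree_append h k

theorem Forest.eq_one_of_degree_eq_zero {h : Forest A} (e : h.degree = 0) : h = 1 := by
  obtain ⟨h⟩ := h
  cases h with
  | nil => rfl
  | cons a h k => change h.degree + 1 + k.degree = 0 at e; omega

/-- The coproduct of a forest is a sum over its admissible cuts, of which there are at most
`2 ^ |g|`: along each cut, the pruned part `p i` and the trunk `q i` share the nodes of `g`.
The bound on the number of cuts does not depend on the labels. -/
theorem exists_comul_eq_sum (g : Forest A) : ∃ (ι : Type) (_ : Fintype ι) (p q : ι → Forest A),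
    Fintype.card ι ≤ 2 ^ g.degree ∧ (∀ i, (p i).degree + (q i).degree = g.degree) ∧
    CK.comul (CK.ofForest g) = ∑ i, CK.ofForest (p i) ⊗ₜ[ℝ] CK.ofForest (q i) := by
  rw [CK.comul_ofForest]
  obtain ⟨g⟩ := g
  change ∃ (ι : Type) (_ : Fintype ι) (p q : ι → Forest A),
    Fintype.card ι ≤ 2 ^ g.degree ∧ (∀ i, (p i).degree + (q i).degree = g.degree) ∧
    g.comul = ∑ i, CK.ofForest (p i) ⊗ₜ[ℝ] CK.ofForest (q i)
  induction g with
  | nil => exact ⟨Unit, inferInstance, fun _ => 1, fun _ => 1, le_rfl, fun _ => rfl, by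
      simp [PlanarForest.comul, CK.ofForest_one, Algebra.TensorProduct.one_def]⟩
  | cons a h k ih₁ ih₂ =>
    obtain ⟨ι, _, p, q, hc, hd, e⟩ := ih₁
    obtain ⟨κ, _, r, s, hc', hd', e'⟩ := ih₂
    refine ⟨Option ι × κ, inferInstance,
      fun i => i.1.elim (Forest.graft a (Forest.mk h)) p * r i.2,
      fun i => i.1.elim 1 (fun i => (q i).graft a) * s i.2, ?_, ?_, ?_⟩
    · rw [Fintype.card_prod, Fintype.card_option, PlanarForest.degree, pow_add]
      gcongr
      rw [pow_succ]
      have := Nat.one_le_two_pow (n := h.degree)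
      omega
    · rintro ⟨_ | i, j⟩
      · simp only [Option.elim, Forest.degree_mul, Forest.degree_graft, Forest.degree_one,
          PlanarForest.degree, ← hd' j]
        change h.degree + 1 + _ + _ = _
        omega
      · simp only [Option.elim, Forest.degree_mul, Forest.degree_graft, PlanarForest.degree,
          ← hd' j, ← hd i]
        omega
    · simp only [PlanarForest.comul, e, e', Fintype.sum_prod_type, Fintype.sum_option,
        Option.elim, map_sum, LinearMap.lTensor_tmul, CK.graft_ofForest, add_mul, Finset.sum_mul,
        Finset.mul_sum]
      simp only [Algebra.TensorProduct.tmul_mul_tmul, CK.ofForest, map_mul, map_one]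
      rw [Finset.sum_add_distrib, Finset.sum_comm, add_comm]

theorem exists_convolution_eq_sum (g : Forest A) : ∃ (ι : Type) (_ : Fintype ι)
    (p q : ι → Forest A),
    Fintype.card ι ≤ 2 ^ g.degree ∧ (∀ i, (p i).degree + (q i).degree = g.degree) ∧
    ∀ φ ψ : CK A →ₗ[ℝ] ℝ, convolution φ ψ (CK.ofForest g) =
      ∑ i, φ (CK.ofForest (p i)) * ψ (CK.ofForest (q i)) := by
  obtain ⟨ι, hι, p, q, hc, hd, e⟩ := exists_comul_eq_sum g
  exact ⟨ι, hι, p, q, hc, hd, fun φ ψ => by simp [convolution, e]⟩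

/-- The number of admissible cuts of `g` with trunk `h`, that is, the number of terms `p ⊗ h` in
`Δ g`. It is computed by convolving the character that is `1` on every forest with `h`. -/
noncomputable def cutCount (g h : Forest A) : ℝ :=
  convolution (MonoidAlgebra.lift ℝ ℝ (Forest A) 1).toLinearMap (dualForest h) (CK.ofForest g)

theorem unit_character_ofForest (g : Forest A) :
    MonoidAlgebra.lift ℝ ℝ (Forest A) 1 (CK.ofForest g) = 1 := by
  simp [CK.ofForest]

theorem cutCount_nonneg (g h : Forest A) : 0 ≤ cutCount g h := by
  classical
  obtain ⟨ι, _, p, q, hc, hd, e⟩ := exists_convolution_eq_sum g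
  rw [cutCount, e]
  refine Finset.sum_nonneg fun i _ => ?_
  rw [AlgHom.toLinearMap_apply, unit_character_ofForest, dualForest_ofForest]
  split_ifs <;> simp

theorem sum_cutCount_le (g : Forest A) (F : Finset (Forest A)) :
    ∑ h ∈ F, cutCount g h ≤ 2 ^ g.degree := by
  classical
  obtain ⟨ι, _, p, q, hc, hd, e⟩ := exists_convolution_eq_sum g
  simp only [cutCount, e, AlgHom.toLinearMap_apply, unit_character_ofForest, dualForest_ofForest,
    one_mul]
  rw [Finset.sum_comm]
  calc ∑ i, ∑ h ∈ F, (if q i = h then (1 : ℝ) else 0) ≤ ∑ i : ι, 1 := by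
        refine Finset.sum_le_sum fun i _ => ?_
        rw [Finset.sum_ite_eq]
        split_ifs <;> simp
    _ = (Fintype.card ι : ℝ) := by simp
    _ ≤ 2 ^ g.degree := by exact_mod_cast hc

/-- For fixed degrees of `g` and `h`, the functional `φ` is only evaluated at pruned parts of the
complementary degree. -/
theorem abs_convolution_dualForest_le {φ : CK A →ₗ[ℝ] ℝ} {g h : Forest A} {B : ℝ}
    (hB : ∀ p : Forest A, p.degree + h.degree = g.degree → |φ (CK.ofForest p)| ≤ B) :
    |convolution φ (dualForest h) (CK.ofForest g)| ≤ cutCount g h * B := by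
  classical
  obtain ⟨ι, _, p, q, hc, hd, e⟩ := exists_convolution_eq_sum g
  rw [cutCount, e, e, Finset.sum_mul]
  refine (Finset.abs_sum_le_sum_abs _ _).trans (Finset.sum_le_sum fun i _ => ?_)
  rw [AlgHom.toLinearMap_apply, unit_character_ofForest, dualForest_ofForest]
  split_ifs with hq
  · simpa using hB (p i) (hq ▸ hd i)
  · simp

theorem mem_forestsLT [Finite A] {n : ℕ} {h : Forest A} : h ∈ forestsLT A n ↔ h.degree < n := by
  simp [forestsLT]

theorem eq_sum_dualForest [Finite A] {n : ℕ} {z : CK A}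
    (hz : z ∈ Submodule.span ℝ (CK.ofForest '' {h : Forest A | h.degree < n})) :
    z = ∑ h ∈ forestsLT A n, dualForest h z • CK.ofForest h := by
  classical
  have H := LinearMap.eqOn_span (f := LinearMap.id)
    (g := ∑ h ∈ forestsLT A n, (dualForest h).smulRight (CK.ofForest h))
    (s := CK.ofForest '' {h : Forest A | h.degree < n}) ?_ hz
  · simpa [LinearMap.sum_apply] using H
  · rintro _ ⟨g, hg, rfl⟩
    simp only [LinearMap.id_apply, LinearMap.sum_apply, LinearMap.smulRight_apply,
      dualForest_ofForest, ite_smul, one_smul, zero_smul]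
    rw [Finset.sum_ite_eq, if_pos (mem_forestsLT.2 hg)]

/-- The trunks of the cuts of a forest have at most as many nodes as the forest. Hence, on elements
of degree less than `n`, the right factor of a convolution may be expanded along the finitely many
forests of degree less than `n`. -/
theorem convolution_eq_sum [Finite A] {n : ℕ} {z : CK A}
    (hz : z ∈ Submodule.span ℝ (CK.ofForest '' {h : Forest A | h.degree < n}))
    (φ ψ : CK A →ₗ[ℝ] ℝ) :
    convolution φ ψ z =
      ∑ h ∈ forestsLT A n, ψ (CK.ofForest h) * convolution φ (dualForest h) z := by
  classical
  have H := LinearMap.eqOn_span (f := convolution φ ψ)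
    (g := ∑ h ∈ forestsLT A n, ψ (CK.ofForest h) • convolution φ (dualForest h))
    (s := CK.ofForest '' {h : Forest A | h.degree < n}) ?_ hz
  · simpa [LinearMap.sum_apply] using H
  · rintro _ ⟨g, hg, rfl⟩
    obtain ⟨ι, _, p, q, hc, hd, e⟩ := exists_convolution_eq_sum g
    simp only [LinearMap.sum_apply, LinearMap.smul_apply, smul_eq_mul, e, Finset.mul_sum,
      dualForest_ofForest]
    rw [Finset.sum_comm]
    refine Finset.sum_congr rfl fun i _ => ?_
    rw [Finset.sum_eq_single (q i)]
    · simp [mul_comm]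
    · intro h _ hne
      simp [hne.symm]
    · intro hq
      refine absurd (mem_forestsLT.2 ?_) hq
      have := hd i
      have : g.degree < n := hg
      omega

theorem dualForest_graft (a : A) (h : Forest A) (z : CK A) :
    dualForest (h.graft a) (CK.graft a z) = dualForest h z := by
  classical
  have : dualForest (h.graft a) ∘ₗ CK.graft a = dualForest h := CK.ext_forest fun k => by
    simp [CK.graft_ofForest, dualForest_ofForest, (Forest.graft_injective a).eq_iff]
  exact LinearMap.congr_fun this z

theorem dualForest_graft_eq_zero {a : A} {k : Forest A} (hk : k ∉ Set.range (Forest.graft a))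
    (z : CK A) : dualForest k (CK.graft a z) = 0 := by
  classical
  have : dualForest k ∘ₗ CK.graft a = 0 := CK.ext_forest fun h => by
    simp only [LinearMap.comp_apply, CK.graft_ofForest, dualForest_ofForest, LinearMap.zero_apply]
    exact if_neg fun e => hk ⟨h, e⟩
  exact LinearMap.congr_fun this z

theorem dualForest_one [DecidableEq (Forest A)] (k : Forest A) :
    dualForest k (1 : CK A) = if k = 1 then 1 else 0 := by
  rw [← CK.ofForest_one, dualForest_ofForest]
  simp only [eq_comm]

theorem one_notMem_range_graft (a : A) : (1 : Forest A) ∉ Set.range (Forest.graft a) := by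
  rintro ⟨h, e⟩
  have := congrArg Forest.degree e
  rw [Forest.degree_graft, Forest.degree_one] at this
  omega

theorem convolution_zero (φ : CK A →ₗ[ℝ] ℝ) : convolution φ 0 = 0 := by
  simp [convolution]

/-- Grafted elements have no cut with empty trunk except the one that prunes the whole tree. -/
theorem convolution_dualForest_one_graft (φ : CK A →ₗ[ℝ] ℝ) (a : A) (z : CK A) :
    convolution φ (dualForest 1) (CK.graft a z) = φ (CK.graft a z) := by
  classical
  rw [convolution_graft, show dualForest 1 ∘ₗ CK.graft a = 0 from
    LinearMap.ext (dualForest_graft_eq_zero (one_notMem_range_graft a)), convolution_zero,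
    dualForest_one]
  simp

theorem convolution_dualForest_graft (φ : CK A →ₗ[ℝ] ℝ) (a : A) (h : Forest A) (z : CK A) :
    convolution φ (dualForest (h.graft a)) (CK.graft a z) = convolution φ (dualForest h) z := by
  classical
  rw [convolution_graft, show dualForest (h.graft a) ∘ₗ CK.graft a = dualForest h from
    LinearMap.ext (dualForest_graft a h), dualForest_one, if_neg]
  · simp
  · exact fun e => one_notMem_range_graft a ⟨h, e⟩

theorem convolution_dualForest_graft_eq_zero (φ : CK A →ₗ[ℝ] ℝ) {a : A} {k : Forest A}
    (hk : k ∉ Set.range (Forest.graft a)) (hk1 : k ≠ 1) (z : CK A) :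
    convolution φ (dualForest k) (CK.graft a z) = 0 := by
  classical
  rw [convolution_graft, show dualForest k ∘ₗ CK.graft a = 0 from
    LinearMap.ext (dualForest_graft_eq_zero hk), convolution_zero, dualForest_one, if_neg hk1]
  simp

theorem convolution_apply_one (φ : CK A →ₐ[ℝ] ℝ) (ψ : CK A →ₗ[ℝ] ℝ) :
    convolution φ.toLinearMap ψ 1 = ψ 1 := by
  simp [convolution, Algebra.TensorProduct.one_def]

end Algebra

/-! ### The sewing lemma and Riemann sums -/

section Sewing

variable {S : Set ℝ} {Ξ : S → S → ℝ} {K θ : ℝ}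

/-- On a finite set of times, the partial sums of `Ξ` along consecutive times are a path whose
increments between consecutive times are those prescribed by `Ξ`. -/
theorem exists_increments_eq_on_consecutive (Ξ : S → S → ℝ) (F : Finset S) :
    ∃ g : S → ℝ, ∀ s ∈ F, ∀ t ∈ F, s < t → (∀ u ∈ F, u ≤ s ∨ t ≤ u) → g t - g s = Ξ s t := by
  induction F using Finset.induction_on_max with
  | empty => exact ⟨fun _ => 0, by simp⟩
  | insert a F ha ih =>
    obtain ⟨g, hg⟩ := ih
    have upd : ∀ (c : ℝ), ∀ u ∈ F, Function.update g a c u = g u := fun c u hu =>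
      Function.update_of_ne (ha u hu).ne _ _
    rcases F.eq_empty_or_nonempty with rfl | hF
    · exact ⟨g, fun s hs t ht hst => by simp_all⟩
    · refine ⟨Function.update g a (g (F.max' hF) + Ξ (F.max' hF) a), ?_⟩
      intro s hs t ht hst hcov
      have hsF : s ∈ F := by
        rcases Finset.mem_insert.1 hs with rfl | h
        · rcases Finset.mem_insert.1 ht with rfl | h
          · exact absurd hst (lt_irrefl _)
          · exact absurd (ha t h) hst.not_gt
        · exact h
      rcases Finset.mem_insert.1 ht with rfl | htF
      · have hs' : s = F.max' hF := by
          refine le_antisymm (F.le_max' s hsF) ?_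
          have hm := F.max'_mem hF
          exact (hcov _ (Finset.mem_insert_of_mem hm)).resolve_right (ha _ hm).not_ge
        rw [upd _ s hsF, Function.update_self, ← hs']
        ring
      · rw [upd _ s hsF, upd _ t htF]
        exact hg s hsF t htF hst fun u hu => hcov u (Finset.mem_insert_of_mem hu)

theorem eq_zero_of_almost_additive (hθ : 1 < θ)
    (hΞ : ∀ (s u t : S) (D : ℝ), |(u - s : ℝ)| ≤ D → |(t - u : ℝ)| ≤ D →
      |Ξ s t - Ξ s u - Ξ u t| ≤ K * D ^ θ) (s : S) : Ξ s s = 0 := by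
  have := hΞ s s s 0 (by simp) (by simp)
  rw [Real.zero_rpow (by linarith), mul_zero] at this
  have := abs_nonpos_iff.1 this
  linarith

/-- The maximal inequality: on a finite set of times, the path of partial sums of an almost additive
`Ξ` has increments close to `Ξ`, with a constant that does not depend on the set. The interval is
cut at the two consecutive times around its midpoint. Both outer pieces have at most half its
length, so their errors sum to a fraction `2 ^ (1 - θ) < 1` of the error allowed for the interval. -/
theorem abs_increment_sub_le (hθ : 1 < θ) (hK : 0 ≤ K)
    (hΞ : ∀ (s u t : S) (D : ℝ), |(u - s : ℝ)| ≤ D → |(t - u : ℝ)| ≤ D →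
      |Ξ s t - Ξ s u - Ξ u t| ≤ K * D ^ θ) {F : Finset S} {g : S → ℝ}
    (hg : ∀ s ∈ F, ∀ t ∈ F, s < t → (∀ u ∈ F, u ≤ s ∨ t ≤ u) → g t - g s = Ξ s t) :
    ∀ s ∈ F, ∀ t ∈ F, s ≤ t →
      |g t - g s - Ξ s t| ≤ 2 * K / (1 - 2 ^ (1 - θ)) * (t - s : ℝ) ^ θ := by
  have h2 : (2 : ℝ) ^ (1 - θ) < 1 := Real.rpow_lt_one_of_one_lt_of_neg one_lt_two (by linarith)
  -- the fixed point of `C ↦ 2 ^ (1 - θ) * C + 2 * K`, the recursion that halving produces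
  set C := 2 * K / (1 - 2 ^ (1 - θ)) with hC
  have hC0 : 0 ≤ C := div_nonneg (by linarith) (by linarith)
  have hCK : 2 ^ (1 - θ) * C + 2 * K = C := by
    rw [hC]
    field_simp [(sub_pos.2 h2).ne']
    ring
  suffices H : ∀ n : ℕ, ∀ s ∈ F, ∀ t ∈ F, s ≤ t → (F.filter fun u => s ≤ u ∧ u < t).card < n →
      |g t - g s - Ξ s t| ≤ C * (t - s : ℝ) ^ θ from
    fun s hs t ht hst => H _ s hs t ht hst (Nat.lt_succ_self _)
  intro n
  induction n with
  | zero => intro s _ t _ _ h; exact absurd h (Nat.not_lt_zero _)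
  | succ n ih =>
    intro s hs t ht hst hn
    rcases hst.eq_or_lt with rfl | hlt
    · simp [eq_zero_of_almost_additive hθ hΞ, Real.zero_rpow (by linarith : θ ≠ 0)]
    have hlt' : (s : ℝ) < t := hlt
    set L : ℝ := t - s with hL
    have hL0 : 0 < L := sub_pos.2 hlt'
    -- `[m, m']` is the consecutive pair of points of `F` that straddles the midpoint of `[s, t]`
    obtain ⟨m, hm, hmax⟩ := (F.filter fun u => s ≤ u ∧ u < t ∧ (u - s : ℝ) ≤ L / 2).exists_max_image
      id ⟨s, by simp [hs, hlt, (half_pos hL0).le]⟩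
    obtain ⟨hmF, hsm, hmt, hmL⟩ := Finset.mem_filter.1 hm
    obtain ⟨m', hm', hmin⟩ := (F.filter fun u => m < u).exists_min_image id ⟨t, by simp [ht, hmt]⟩
    obtain ⟨hmF', hmm'⟩ := Finset.mem_filter.1 hm'
    have hmt' : m' ≤ t := hmin t (by simp [ht, hmt])
    have hsm' : s ≤ m' := hsm.trans hmm'.le
    have c1 : (s : ℝ) ≤ m := hsm
    have c2 : (m : ℝ) < m' := hmm'
    have c3 : (m' : ℝ) ≤ t := hmt'
    have hL' : (t - m' : ℝ) ≤ L / 2 := by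
      rcases hmt'.eq_or_lt with h | h
      · rw [h]; linarith
      · by_contra! hc
        have := hmax m' (by
          simp only [Finset.mem_filter]
          exact ⟨hmF', hsm', h, by linarith⟩)
        exact absurd hmm' (not_lt.2 this)
    have hcov : g m' - g m = Ξ m m' := by
      refine hg m hmF m' hmF' hmm' fun u hu => ?_
      rcases le_or_gt u m with h | h
      · exact Or.inl h
      · exact Or.inr (hmin u (by simp [hu, h]))
    have i1 := ih s hs m hmF hsm (by
      refine lt_of_lt_of_le (Finset.card_lt_card ?_) (Nat.lt_succ_iff.1 hn)
      refine Finset.ssubset_iff_of_subset ?_ |>.2 ⟨m, by simp [hmF, hsm, hmt], by simp⟩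
      intro u hu
      simp only [Finset.mem_filter] at hu ⊢
      exact ⟨hu.1, hu.2.1, hu.2.2.trans hmt⟩)
    have i2 := ih m' hmF' t ht hmt' (by
      refine lt_of_lt_of_le (Finset.card_lt_card ?_) (Nat.lt_succ_iff.1 hn)
      refine Finset.ssubset_iff_of_subset ?_ |>.2 ⟨s, by simp [hs, hlt],
        by simp [hsm.trans_lt hmm']⟩
      intro u hu
      simp only [Finset.mem_filter] at hu ⊢
      exact ⟨hu.1, hsm'.trans hu.2.1, hu.2.2⟩)
    have e1 : (m - s : ℝ) ^ θ ≤ (L / 2) ^ θ :=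
      Real.rpow_le_rpow (by linarith) hmL (by linarith)
    have e2 : (t - m' : ℝ) ^ θ ≤ (L / 2) ^ θ :=
      Real.rpow_le_rpow (by linarith) hL' (by linarith)
    have d1 := hΞ s m' t L (by rw [abs_le]; constructor <;> linarith)
      (by rw [abs_le]; constructor <;> linarith)
    have d2 := hΞ s m m' L (by rw [abs_le]; constructor <;> linarith)
      (by rw [abs_le]; constructor <;> linarith)
    have e3 : 2 * (C * (L / 2) ^ θ) = 2 ^ (1 - θ) * C * L ^ θ := by
      rw [Real.div_rpow hL0.le zero_le_two, Real.rpow_sub two_pos, Real.rpow_one]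
      ring
    have split : g t - g s - Ξ s t = (g t - g m' - Ξ m' t) + (g m - g s - Ξ s m) -
        (Ξ s t - Ξ s m' - Ξ m' t) - (Ξ s m' - Ξ s m - Ξ m m') := by
      rw [← hcov]; ring
    calc |g t - g s - Ξ s t|
        ≤ |g t - g m' - Ξ m' t| + |g m - g s - Ξ s m| +
          |Ξ s t - Ξ s m' - Ξ m' t| + |Ξ s m' - Ξ s m - Ξ m m'| := by
          rw [split]
          refine (abs_sub _ _).trans (add_le_add_left ?_ _)
          refine (abs_sub _ _).trans (add_le_add_left ?_ _)
          exact abs_add_le _ _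
      _ ≤ C * (L / 2) ^ θ + C * (L / 2) ^ θ + K * L ^ θ + K * L ^ θ := by
          refine add_le_add (add_le_add (add_le_add ?_ ?_) d1) d2
          · exact i2.trans (mul_le_mul_of_nonneg_left e2 hC0)
          · exact i1.trans (mul_le_mul_of_nonneg_left e1 hC0)
      _ = (2 ^ (1 - θ) * C + 2 * K) * L ^ θ := by linear_combination e3
      _ = C * L ^ θ := by rw [hCK]

/-- The sewing lemma. The paths of partial sums along finite sets of times are uniformly close to
`Ξ`, so they converge along an ultrafilter of ever larger finite sets, and the estimate passes to
the limit. Times need not be ordered. -/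
theorem exists_sewing (hθ : 1 < θ) (hK : 0 ≤ K)
    (hΞ : ∀ (s u t : S) (D : ℝ), |(u - s : ℝ)| ≤ D → |(t - u : ℝ)| ≤ D →
      |Ξ s t - Ξ s u - Ξ u t| ≤ K * D ^ θ) :
    ∃ g : S → ℝ, ∀ s t : S,
      |g t - g s - Ξ s t| ≤ (2 / (1 - 2 ^ (1 - θ)) + 1) * K * |(t - s : ℝ)| ^ θ := by
  classical
  rcases isEmpty_or_nonempty S with hS | ⟨⟨t₀⟩⟩
  · exact ⟨fun _ => 0, fun s => isEmptyElim s⟩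
  set C := (2 / (1 - 2 ^ (1 - θ)) + 1) * K with hC
  have hCK : 2 * K / (1 - 2 ^ (1 - θ)) + K = C := by rw [hC]; ring
  choose g hg using exists_increments_eq_on_consecutive Ξ
  have bound : ∀ (F : Finset S), ∀ s ∈ F, ∀ t ∈ F,
      |g F t - g F s - Ξ s t| ≤ C * |(t - s : ℝ)| ^ θ := by
    intro F s hs t ht
    rw [← hCK, add_mul]
    have hK' : 0 ≤ K * |(t - s : ℝ)| ^ θ := by positivity
    rcases le_total s t with h | h
    · have h' : (s : ℝ) ≤ t := h
      have := abs_increment_sub_le hθ hK hΞ (hg F) s hs t ht h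
      rw [abs_of_nonneg (sub_nonneg.2 h')] at hK' ⊢
      linarith
    · have h' : (t : ℝ) ≤ s := h
      have i1 := abs_increment_sub_le hθ hK hΞ (hg F) t ht s hs h
      have i2 := hΞ s t s |(t - s : ℝ)| le_rfl (abs_sub_comm _ _).le
      rw [eq_zero_of_almost_additive hθ hΞ s] at i2
      have e : g F t - g F s - Ξ s t = (0 - Ξ s t - Ξ t s) - (g F s - g F t - Ξ t s) := by ring
      rw [abs_sub_comm (t : ℝ) s, abs_of_nonneg (sub_nonneg.2 h')] at *
      rw [e]
      exact (abs_sub _ _).trans (by linarith)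
  -- an ultrafilter of finer and finer finite sets of times
  let U : Ultrafilter (Finset S) := Ultrafilter.of atTop
  have hU : ∀ s : S, ∀ᶠ F in (U : Filter (Finset S)), s ∈ F := fun s => by
    filter_upwards [Ultrafilter.of_le atTop (eventually_ge_atTop {s})] with F hF
    exact hF (Finset.mem_singleton_self s)
  have lim : ∀ t : S, ∃ x : ℝ, Tendsto (fun F => g F t - g F t₀) U (𝓝 x) := by
    intro t
    set B := |Ξ t₀ t| + C * |(t - t₀ : ℝ)| ^ θ
    obtain ⟨x, -, hx⟩ := (isCompact_Icc (a := -B) (b := B)).ultrafilter_le_nhds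
      (U.map fun F => g F t - g F t₀) (by
        rw [le_principal_iff]
        change ∀ᶠ F in (U : Filter (Finset S)), g F t - g F t₀ ∈ Set.Icc (-B) B
        filter_upwards [hU t, hU t₀] with F ht ht₀
        have := bound F t₀ ht₀ t ht
        rw [Set.mem_Icc, ← abs_le]
        have e : g F t - g F t₀ = Ξ t₀ t + (g F t - g F t₀ - Ξ t₀ t) := by ring
        rw [e]
        exact (abs_add_le _ _).trans (add_le_add_right this _))
    exact ⟨x, hx⟩
  choose G hG using lim
  refine ⟨G, fun s t => ?_⟩
  refine le_of_tendsto (((hG t).sub (hG s)).sub_const (Ξ s t)).abs ?_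
  filter_upwards [hU s, hU t] with F hs ht
  simpa only [sub_sub_sub_cancel_right] using bound F s hs t ht

end Sewing

theorem IntervalPartition.sum_increments {T : ℝ} {s t : Time T} (π : IntervalPartition s t)
    {M : Type*} [AddCommGroup M] (g : Time T → M) :
    ∑ i : Fin π.size, (g (π.point i.succ) - g (π.point i.castSucc)) = g t - g s := by
  have H : ∀ (n : ℕ) (f : Fin (n + 1) → M),
      ∑ i : Fin n, (f i.succ - f i.castSucc) = f (Fin.last n) - f 0 := by
    intro n f
    rw [Finset.sum_sub_distrib, sub_eq_sub_iff_add_eq_add, add_comm, ← Fin.sum_univ_succ,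
      add_comm (f (Fin.last n)), ← Fin.sum_univ_castSucc]
  rw [H π.size fun i => g (π.point i), π.last, π.first]

theorem IntervalPartition.length_le_mesh {T : ℝ} {s t : Time T} (π : IntervalPartition s t)
    (i : Fin π.size) : ((π.point i.succ : ℝ) - (π.point i.castSucc : ℝ)) ≤ π.mesh :=
  le_ciSup (f := fun i : Fin π.size => ((π.point i.succ : ℝ) - (π.point i.castSucc : ℝ)))
    (Set.finite_range _).bddAbove i

theorem IntervalPartition.length_nonneg {T : ℝ} {s t : Time T} (π : IntervalPartition s t)
    (i : Fin π.size) : 0 ≤ ((π.point i.succ : ℝ) - (π.point i.castSucc : ℝ)) :=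
  sub_nonneg.2 (π.mono i.castSucc_lt_succ.le)

theorem IntervalPartition.mesh_nonneg {T : ℝ} {s t : Time T} (π : IntervalPartition s t) :
    0 ≤ π.mesh := Real.iSup_nonneg π.length_nonneg

/-- A path whose increments are approximated by `Ξ` to an order above `1` is the limit of the
Riemann sums of `Ξ`: on a partition `π` of `[s, t]` the error is at most
`C * (t - s) * |π| ^ (θ - 1)`. -/
theorem tendsto_sum_of_abs_increment_sub_le {T : ℝ} {Ξ : Time T → Time T → ℝ}
    {g : Time T → ℝ} {C θ : ℝ} (hθ : 1 < θ) (hC : 0 ≤ C)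
    (h : ∀ s t : Time T, |g t - g s - Ξ s t| ≤ C * |(t - s : ℝ)| ^ θ) (s t : Time T) :
    Tendsto (fun π : IntervalPartition s t =>
      ∑ i : Fin π.size, Ξ (π.point i.castSucc) (π.point i.succ)) (meshToZero s t)
      (𝓝 (g t - g s)) := by
  have hmesh : Tendsto (fun π : IntervalPartition s t => C * (t - s : ℝ) * π.mesh ^ (θ - 1))
      (meshToZero s t) (𝓝 0) := by
    have := ((tendsto_comap (f := IntervalPartition.mesh (s := s) (t := t))
      (x := 𝓝 0)).rpow_const (p := θ - 1) (Or.inr (by linarith))).const_mul (C * (t - s : ℝ))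
    rwa [Real.zero_rpow (by linarith), mul_zero] at this
  rw [tendsto_iff_dist_tendsto_zero]
  refine squeeze_zero (fun _ => dist_nonneg) (fun π => ?_) hmesh
  rw [dist_comm, Real.dist_eq, ← π.sum_increments g, ← Finset.sum_sub_distrib]
  calc |∑ i : Fin π.size, (g (π.point i.succ) - g (π.point i.castSucc) -
        Ξ (π.point i.castSucc) (π.point i.succ))|
      ≤ ∑ i : Fin π.size, C * π.mesh ^ (θ - 1) *
          ((π.point i.succ : ℝ) - (π.point i.castSucc : ℝ)) := by
        refine (Finset.abs_sum_le_sum_abs _ _).trans (Finset.sum_le_sum fun i _ => ?_)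
        refine (h _ _).trans ?_
        have h0 := π.length_nonneg i
        rw [abs_of_nonneg h0, mul_assoc]
        refine mul_le_mul_of_nonneg_left ?_ hC
        rcases h0.eq_or_lt with h1 | h1
        · rw [← h1, Real.zero_rpow (by linarith), mul_zero]
        · nth_rewrite 1 [show θ = θ - 1 + 1 by ring]
          rw [Real.rpow_add_one h1.ne']
          exact mul_le_mul_of_nonneg_right
            (Real.rpow_le_rpow h0 (π.length_le_mesh i) (by linarith)) h0
    _ = C * (t - s : ℝ) * π.mesh ^ (θ - 1) := by
        rw [← Finset.mul_sum, π.sum_increments (fun u => (u : ℝ))]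
        ring

/-- The uniform partition of `[s, t]` into `n + 1` intervals. -/
noncomputable def IntervalPartition.uniform {T : ℝ} {s t : Time T} (hst : s ≤ t) (n : ℕ) :
    IntervalPartition s t where
  size := n + 1
  point i := ⟨s + (i : ℝ) / (n + 1) * (t - s), by
    have hi : (i : ℝ) / (n + 1) ≤ 1 := by
      rw [div_le_one (by positivity)]
      exact_mod_cast Nat.lt_succ_iff.1 i.2
    have hst' : (s : ℝ) ≤ t := hst
    have h0 : 0 ≤ (i : ℝ) / (n + 1) := by positivity
    exact ⟨by nlinarith [s.2.1], by nlinarith [t.2.2]⟩⟩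
  mono i j hij := by
    have hst' : (0 : ℝ) ≤ t - s := sub_nonneg.2 hst
    have hij' : (i : ℝ) ≤ j := by exact_mod_cast hij
    change (s : ℝ) + (i : ℝ) / (n + 1) * (t - s) ≤ s + (j : ℝ) / (n + 1) * (t - s)
    gcongr
  first := by simp
  last := by
    have : (n + 1 : ℝ) ≠ 0 := by positivity
    ext
    simp [this]

/-- There are partitions of arbitrarily small mesh, so limits as `|π| → 0` are unique. -/
theorem meshToZero_neBot {T : ℝ} {s t : Time T} (hst : s ≤ t) : (meshToZero s t).NeBot := by
  have hst' : (0 : ℝ) ≤ t - s := sub_nonneg.2 hst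
  have H : Tendsto (fun n : ℕ => (IntervalPartition.uniform hst n).mesh) atTop (𝓝 0) := by
    refine squeeze_zero (fun n => IntervalPartition.mesh_nonneg _) (fun n => ?_)
      (tendsto_const_div_atTop_nhds_zero_nat (t - s : ℝ) |>.comp (tendsto_add_atTop_nat 1))
    have h0 : 0 ≤ (t - s : ℝ) / ((n + 1 : ℕ) : ℝ) := by positivity
    refine Real.iSup_le (fun i => le_of_eq ?_) h0
    change (s + ((i.val + 1 : ℕ) : ℝ) / (n + 1) * (t - s) : ℝ) -
      (s + (i.val : ℝ) / (n + 1) * (t - s)) = (t - s : ℝ) / ((n + 1 : ℕ) : ℝ)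
    push_cast
    ring
  exact comap_neBot_iff.2 fun U hU => by
    obtain ⟨n, hn⟩ := (H.eventually hU).exists
    exact ⟨_, hn⟩

/-! ### Integration of controlled paths -/

section Integration

variable {A : Type*} {α T : ℝ}

theorem Time.abs_sub_le (s t : Time T) : |(t : ℝ) - s| ≤ T :=
  abs_sub_le_iff.2 ⟨by linarith [s.2.1, t.2.2], by linarith [t.2.1, s.2.2]⟩

theorem holderNorm_nonneg (γ : ℝ) (f : Time T → Time T → ℝ) : 0 ≤ holderNorm γ f :=
  Real.iSup_nonneg fun _ => by positivity

theorem holderNorm_le {γ K : ℝ} {f : Time T → Time T → ℝ} (hK : 0 ≤ K)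
    (h : ∀ s t : Time T, |f s t| ≤ K * |(t : ℝ) - s| ^ γ) : holderNorm γ f ≤ K := by
  refine Real.iSup_le (fun p => ?_) hK
  exact div_le_of_le_mul₀ (by positivity) hK (h _ _)

/-- The supremum defining `holderNorm` leaves out `s = t`; there the assumed bound gives
`0`, because `γ ≠ 0`. -/
theorem abs_le_holderNorm_mul {γ : ℝ} (hγ : γ ≠ 0) {f : Time T → Time T → ℝ}
    (h : ∃ K : ℝ, ∀ s t : Time T, |f s t| ≤ K * |(t : ℝ) - s| ^ γ) (s t : Time T) :
    |f s t| ≤ holderNorm γ f * |(t : ℝ) - s| ^ γ := by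
  obtain ⟨K, hK⟩ := h
  have hpos : ∀ {s t : Time T}, s ≠ t → 0 < |(t : ℝ) - s| ^ γ := fun hst =>
    Real.rpow_pos_of_pos (abs_pos.2 (sub_ne_zero.2 fun e => hst (Subtype.ext e.symm))) _
  rcases eq_or_ne s t with rfl | hst
  · simpa [Real.zero_rpow hγ] using hK s s
  · rw [← div_le_iff₀ (hpos hst)]
    refine le_ciSup (f := fun p : {p : Time T × Time T // p.1 ≠ p.2} =>
      |f p.1.1 p.1.2| / |(p.1.2 : ℝ) - (p.1.1 : ℝ)| ^ γ) ⟨K, ?_⟩ ⟨(s, t), hst⟩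
    rintro _ ⟨p, rfl⟩
    exact (div_le_iff₀ (hpos p.2)).2 (hK _ _)

theorem one_le_order (hα₀ : 0 < α) (hα₁ : α < 1) : 1 ≤ order α :=
  Nat.le_floor (by simpa using (one_le_inv₀ hα₀).2 hα₁.le)

/-- The exponent of the germ defect exceeds `1`, as sewing requires. -/
theorem one_lt_order_add_one_mul (hα₀ : 0 < α) : 1 < ((order α : ℝ) + 1) * α := by
  have := mul_lt_mul_of_pos_right (Nat.lt_floor_add_one α⁻¹) hα₀
  rwa [inv_mul_cancel₀ hα₀.ne'] at this

namespace BranchedRoughPath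

variable (X : BranchedRoughPath A α T)

theorem norm_nonneg : 0 ≤ X.norm := Real.iSup_nonneg fun _ => holderNorm_nonneg _ _

theorem abs_component_le [Finite A] (hα₀ : 0 < α) {h : Forest A} (h₁ : 1 ≤ h.degree)
    (h₂ : h.degree ≤ order α) (s t : Time T) :
    |X.component h s t| ≤ X.norm * |(t : ℝ) - s| ^ (h.degree * α) := by
  have hγ : (h.degree * α : ℝ) ≠ 0 :=
    mul_ne_zero (Nat.cast_ne_zero.2 (Nat.one_le_iff_ne_zero.1 h₁)) hα₀.ne'
  refine (abs_le_holderNorm_mul hγ ?_ s t).trans ?_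
  · obtain ⟨K, hK⟩ := X.holder h
    exact ⟨K, fun s t => by simpa only [component, mul_comm α] using hK s t⟩
  · refine mul_le_mul_of_nonneg_right ?_ (by positivity)
    have : Finite {h : Forest A // 1 ≤ h.degree ∧ h.degree ≤ order α} :=
      ((Forest.finite_degree_lt (A := A) (order α + 1)).subset fun k hk =>
        Nat.lt_succ_of_le hk.2).to_subtype
    exact le_ciSup (f := fun h : {h : Forest A // 1 ≤ h.degree ∧ h.degree ≤ order α} =>
      holderNorm (h.1.degree * α) (X.component h.1)) (Set.finite_range _).bddAbove ⟨h, h₁, h₂⟩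

variable {X}

theorem abs_remainder_le (hα₀ : 0 < α) {Z : Time T → CK A} (hZ : Z ∈ X.controlledPaths)
    {h : Forest A} (hh : h.degree < order α)
    (s t : Time T) : |X.remainder Z h s t| ≤
      holderNorm (((order α : ℝ) - h.degree) * α) (X.remainder Z h) *
        |(t : ℝ) - s| ^ (((order α : ℝ) - h.degree) * α) :=
  abs_le_holderNorm_mul (mul_ne_zero (sub_pos.2 (Nat.cast_lt.2 hh)).ne' hα₀.ne') (hZ.2 h hh) s t

/-- The summand of the compensated Riemann sum is `X_{s,t}` applied to the graft of `Z_s`. -/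
theorem sum_component_eq [Finite A] {Z : Time T → CK A} (hZ : Z ∈ X.controlledPaths) (a : A)
    (s t : Time T) :
    ∑ h ∈ forestsLT A (order α), dualForest h (Z s) * X.component (h.graft a) s t =
      X.toFun s t (CK.graft a (Z s)) := by
  conv_rhs => rw [eq_sum_dualForest (hZ.1 s)]
  simp only [map_sum, map_smul, CK.graft_ofForest, smul_eq_mul, component]

/-- The defect of additivity of the germ `X_{s,t} [Z_s]_a`. By Chen's relation and the recursion for
`Δ`, it consists of products of a component of `X` and a remainder of `Z`. -/
theorem germ_defect [Finite A] {Z : Time T → CK A} (hZ : Z ∈ X.controlledPaths) (a : A)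
    (s u t : Time T) :
    X.toFun s t (CK.graft a (Z s)) - X.toFun s u (CK.graft a (Z s)) -
        X.toFun u t (CK.graft a (Z u)) =
      -∑ h ∈ forestsLT A (order α), X.component (h.graft a) u t * X.remainder Z h s u := by
  have h1 : X.toFun s t (CK.graft a (Z s)) =
      (∑ h ∈ forestsLT A (order α), X.component (h.graft a) u t *
        convolution (X.toFun s u).toLinearMap (dualForest h) (Z s)) +
        X.toFun s u (CK.graft a (Z s)) := by
    have := LinearMap.congr_fun (X.chen s u t) (CK.graft a (Z s))
    rw [convolution_graft, convolution_eq_sum (hZ.1 s)] at this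
    simpa [CK.graft_ofForest, component] using this.symm
  rw [h1, ← sum_component_eq hZ a u t]
  simp only [remainder, mul_sub, Finset.sum_sub_distrib]
  rw [Finset.sum_congr rfl fun h _ => mul_comm (dualForest h (Z u)) _]
  ring

theorem sum_abs_le_controlledNorm [Finite A] (hT : 0 < T) (Z : Time T → CK A) :
    ∑ h ∈ forestsLT A (order α), |dualForest h (Z (Time.zero hT))| ≤ X.controlledNorm hT Z :=
  Finset.sum_le_sum fun _ _ => le_add_of_nonneg_right (holderNorm_nonneg _ _)

theorem sum_holderNorm_le_controlledNorm [Finite A] (hT : 0 < T) (Z : Time T → CK A) :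
    ∑ h ∈ forestsLT A (order α), holderNorm (((order α : ℝ) - h.degree) * α) (X.remainder Z h) ≤
      X.controlledNorm hT Z :=
  Finset.sum_le_sum fun _ _ => le_add_of_nonneg_left (abs_nonneg _)

theorem controlledNorm_nonneg [Finite A] (hT : 0 < T) (Z : Time T → CK A) :
    0 ≤ X.controlledNorm hT Z :=
  Finset.sum_nonneg fun _ _ => add_nonneg (abs_nonneg _) (holderNorm_nonneg _ _)

/-- In each term of the defect, the exponents `(|h| + 1) α` of `X^{[h]_a}` and
`(N - |h|) α` of `R^h` add up to `(N + 1) α`. -/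
theorem abs_germ_defect_le [Finite A] (hα₀ : 0 < α) (hT : 0 < T) {Z : Time T → CK A}
    (hZ : Z ∈ X.controlledPaths) (a : A) (s u t : Time T) (D : ℝ)
    (hsu : |(u : ℝ) - s| ≤ D) (hut : |(t : ℝ) - u| ≤ D) :
    |X.toFun s t (CK.graft a (Z s)) - X.toFun s u (CK.graft a (Z s)) -
        X.toFun u t (CK.graft a (Z u))| ≤
      X.norm * X.controlledNorm hT Z * D ^ (((order α : ℝ) + 1) * α) := by
  have hD : 0 ≤ D := (abs_nonneg _).trans hsu
  have hM := X.norm_nonneg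
  rw [germ_defect hZ, abs_neg]
  calc |∑ h ∈ forestsLT A (order α), X.component (h.graft a) u t * X.remainder Z h s u|
      ≤ ∑ h ∈ forestsLT A (order α), X.norm * D ^ (((order α : ℝ) + 1) * α) *
          holderNorm (((order α : ℝ) - h.degree) * α) (X.remainder Z h) := by
        refine (Finset.abs_sum_le_sum_abs _ _).trans (Finset.sum_le_sum fun h hh => ?_)
        have hh' := mem_forestsLT.1 hh
        have hc : ((h.degree : ℝ)) + 1 ≤ order α := by exact_mod_cast hh'
        have e1 := X.abs_component_le hα₀ (h := h.graft a) (by rw [Forest.degree_graft]; omega)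
            (by rw [Forest.degree_graft]; omega) u t
        have e2 := abs_remainder_le hα₀ hZ hh' s u
        rw [Forest.degree_graft] at e1
        push_cast at e1
        have e3 : D ^ (((order α : ℝ) + 1) * α) =
            D ^ (((h.degree : ℝ) + 1) * α) * D ^ (((order α : ℝ) - h.degree) * α) := by
          rw [← Real.rpow_add_of_nonneg hD (by positivity) (mul_nonneg (by linarith) hα₀.le)]
          congr 1
          ring
        have hr := holderNorm_nonneg (((order α : ℝ) - h.degree) * α) (X.remainder Z h)
        rw [abs_mul, e3]
        calc _ ≤ (X.norm * D ^ (((h.degree : ℝ) + 1) * α)) *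
              (holderNorm (((order α : ℝ) - h.degree) * α) (X.remainder Z h) *
                D ^ (((order α : ℝ) - h.degree) * α)) := by
              refine mul_le_mul (e1.trans ?_) (e2.trans ?_) (abs_nonneg _) (by positivity)
              · gcongr
              · gcongr
                exact mul_nonneg (by linarith) hα₀.le
          _ = _ := by ring
    _ ≤ _ := by
        rw [← Finset.mul_sum, mul_right_comm]
        gcongr
        exact sum_holderNorm_le_controlledNorm hT Z

/-- The part of degree `N - 1` of an element `z` of the span of the forests with fewer than `N`
nodes. This is the part of an integrand that the integration map does not keep. -/
noncomputable def topPart [Finite A] (α : ℝ) (z : CK A) : CK A :=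
  ∑ g ∈ (forestsLT A (order α)).filter (fun g => ¬ g.degree + 1 < order α),
    dualForest g z • CK.ofForest g

/-- A bound, uniform in time, for the component of a controlled path along a forest `g` with `N - 1`
nodes: `⟨g, Z_s⟩ = R^g_{0,s} + ⟨X_{0,s} ⋆ g, Z_0⟩`, where only the empty forest can be pruned in the
second term. -/
noncomputable def topBound [Finite A] (X : BranchedRoughPath A α T) (hT : 0 < T)
    (Z : Time T → CK A) (g : Forest A) : ℝ :=
  holderNorm (((order α : ℝ) - g.degree) * α) (X.remainder Z g) * T ^ α +
    ∑ k ∈ forestsLT A (order α), |dualForest k (Z (Time.zero hT))| * cutCount k g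

theorem topBound_nonneg [Finite A] (hT : 0 < T) (Z : Time T → CK A) (g : Forest A) :
    0 ≤ X.topBound hT Z g :=
  add_nonneg (mul_nonneg (holderNorm_nonneg _ _) (by positivity))
    (Finset.sum_nonneg fun _ _ => mul_nonneg (abs_nonneg _) (cutCount_nonneg _ _))

theorem abs_dualForest_le_topBound [Finite A] (hα₀ : 0 < α) (hT : 0 < T) {Z : Time T → CK A}
    (hZ : Z ∈ X.controlledPaths) {g : Forest A} (hg : g.degree + 1 = order α) (s : Time T) :
    |dualForest g (Z s)| ≤ X.topBound hT Z g := by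
  have e : dualForest g (Z s) = X.remainder Z g (Time.zero hT) s +
      convolution (X.toFun (Time.zero hT) s).toLinearMap (dualForest g) (Z (Time.zero hT)) := by
    rw [remainder]; ring
  rw [e]
  refine (abs_add_le _ _).trans (add_le_add ?_ ?_)
  · -- at top degree, the exponent of the remainder is `α`
    have hγ : ((order α : ℝ) - g.degree) * α = α := by rw [← hg]; push_cast; ring
    refine (abs_remainder_le hα₀ hZ (by omega) _ _).trans ?_
    refine mul_le_mul_of_nonneg_left ?_ (holderNorm_nonneg _ _)
    rw [hγ]
    exact Real.rpow_le_rpow (abs_nonneg _) (Time.abs_sub_le _ _) hα₀.le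
  · conv_lhs => rw [eq_sum_dualForest (hZ.1 (Time.zero hT))]
    rw [map_sum]
    refine (Finset.abs_sum_le_sum_abs _ _).trans (Finset.sum_le_sum fun k hk => ?_)
    rw [map_smul, smul_eq_mul, abs_mul]
    refine mul_le_mul_of_nonneg_left ?_ (abs_nonneg _)
    rw [← mul_one (cutCount k g)]
    refine abs_convolution_dualForest_le fun p hp => ?_
    have hk' := mem_forestsLT.1 hk
    rw [Forest.eq_one_of_degree_eq_zero (h := p) (by omega), CK.ofForest_one]
    simp

/-- The bounds on the components of degree `N - 1` are summable against the controlled norm, with a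
constant that does not depend on the number of labels: for fixed `k`, the cut counts of `k` sum to
at most `2 ^ |k|`. -/
theorem sum_topBound_le [Finite A] (hT : 0 < T) (Z : Time T → CK A) :
    ∑ g ∈ (forestsLT A (order α)).filter (fun g => ¬ g.degree + 1 < order α), X.topBound hT Z g ≤
      2 ^ order α * (1 + T ^ α) * X.controlledNorm hT Z := by
  have hZ0 := X.controlledNorm_nonneg hT Z
  have h1 : (1 : ℝ) ≤ 2 ^ order α := one_le_pow₀ one_le_two
  refine (Finset.sum_le_sum_of_subset_of_nonneg (Finset.filter_subset _ _)
    fun _ _ _ => topBound_nonneg hT Z _).trans ?_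
  simp only [topBound]
  rw [Finset.sum_add_distrib, ← Finset.sum_mul, Finset.sum_comm]
  have e1 : (∑ g ∈ forestsLT A (order α),
      holderNorm (((order α : ℝ) - g.degree) * α) (X.remainder Z g)) * T ^ α ≤
        2 ^ order α * (X.controlledNorm hT Z * T ^ α) :=
    (mul_le_mul_of_nonneg_right (sum_holderNorm_le_controlledNorm hT Z) (by positivity)).trans
      (le_mul_of_one_le_left (by positivity) h1)
  have e2 : ∑ k ∈ forestsLT A (order α), ∑ g ∈ forestsLT A (order α),
      |dualForest k (Z (Time.zero hT))| * cutCount k g ≤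
        X.controlledNorm hT Z * 2 ^ order α := by
    refine le_trans (Finset.sum_le_sum fun k hk => ?_)
      ((Finset.sum_mul _ _ _).symm.trans_le (mul_le_mul_of_nonneg_right
        (sum_abs_le_controlledNorm (X := X) hT Z) (by positivity)))
    rw [← Finset.mul_sum]
    refine mul_le_mul_of_nonneg_left ?_ (abs_nonneg _)
    exact (sum_cutCount_le _ _).trans (pow_le_pow_right₀ one_le_two (mem_forestsLT.1 hk).le)
  linarith

theorem sum_add_topPart [Finite A] {z : CK A}
    (hz : z ∈ Submodule.span ℝ (CK.ofForest '' {h : Forest A | h.degree < order α})) :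
    ∑ h ∈ (forestsLT A (order α)).filter (fun h => h.degree + 1 < order α),
      dualForest h z • CK.ofForest h = z - topPart α z := by
  rw [eq_sub_iff_add_eq, topPart, Finset.sum_filter_add_sum_filter_not]
  exact (eq_sum_dualForest hz).symm

theorem abs_apply_topPart_le [Finite A] (hα₀ : 0 < α) (hT : 0 < T) {Z : Time T → CK A}
    (hZ : Z ∈ X.controlledPaths) (ℓ : CK A →ₗ[ℝ] ℝ) {b : Forest A → ℝ}
    (hb : ∀ g : Forest A, g.degree + 1 = order α → |ℓ (CK.ofForest g)| ≤ b g) (s : Time T) :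
    |ℓ (topPart α (Z s))| ≤
      ∑ g ∈ (forestsLT A (order α)).filter (fun g => ¬ g.degree + 1 < order α),
        X.topBound hT Z g * b g := by
  rw [topPart, map_sum]
  refine (Finset.abs_sum_le_sum_abs _ _).trans (Finset.sum_le_sum fun g hg => ?_)
  obtain ⟨hg1, hg2⟩ := Finset.mem_filter.1 hg
  have hg' : g.degree + 1 = order α := by
    have := mem_forestsLT.1 hg1
    omega
  rw [map_smul, smul_eq_mul, abs_mul]
  exact mul_le_mul (abs_dualForest_le_topBound hα₀ hT hZ hg' s) (hb g hg') (abs_nonneg _)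
    (topBound_nonneg hT Z g)

theorem dualForest_topPart [Finite A] {h : Forest A} (hh : h.degree + 1 < order α) (z : CK A) :
    dualForest h (topPart α z) = 0 := by
  classical
  rw [topPart, map_sum]
  refine Finset.sum_eq_zero fun g hg => ?_
  rw [map_smul, dualForest_ofForest, if_neg, smul_zero]
  rintro rfl
  exact (Finset.mem_filter.1 hg).2 hh

/-- The integral is the graft of the integrand without its part of degree `N - 1`, plus a scalar
path. In this form the coproduct recursion applies to it. -/
theorem integrationMap_eq [Finite A] (hT : 0 < T) (a : A) {Z : Time T → CK A}
    (hZ : Z ∈ X.controlledPaths) (t : Time T) :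
    X.integrationMap hT a Z t =
      X.roughIntegral hT a Z t • 1 + CK.graft a (Z t - topPart α (Z t)) := by
  rw [integrationMap, CK.ofForest_one, ← sum_add_topPart (hZ.1 t), map_sum]
  simp only [map_smul, CK.graft_ofForest]

theorem dualForest_one_integrationMap [Finite A] (hT : 0 < T) (a : A) {Z : Time T → CK A}
    (hZ : Z ∈ X.controlledPaths) (t : Time T) :
    dualForest 1 (X.integrationMap hT a Z t) = X.roughIntegral hT a Z t := by
  classical
  rw [integrationMap_eq hT a hZ, map_add, map_smul, dualForest_one,
    dualForest_graft_eq_zero (one_notMem_range_graft a)]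
  simp

theorem dualForest_graft_integrationMap [Finite A] (hT : 0 < T) (a : A) {Z : Time T → CK A}
    (hZ : Z ∈ X.controlledPaths) {h : Forest A}
    (hh : h.degree + 1 < order α) (t : Time T) :
    dualForest (h.graft a) (X.integrationMap hT a Z t) = dualForest h (Z t) := by
  classical
  rw [integrationMap_eq hT a hZ, map_add, map_smul, dualForest_one, dualForest_graft, map_sub,
    dualForest_topPart hh, if_neg (fun e => one_notMem_range_graft a ⟨h, e⟩)]
  simp

theorem dualForest_integrationMap_eq_zero [Finite A] (hT : 0 < T) (a : A) {Z : Time T → CK A}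
    (hZ : Z ∈ X.controlledPaths) {k : Forest A} (hk : k ∉ Set.range (Forest.graft a))
    (hk1 : k ≠ 1) (t : Time T) :
    dualForest k (X.integrationMap hT a Z t) = 0 := by
  classical
  rw [integrationMap_eq hT a hZ, map_add, map_smul, dualForest_one, dualForest_graft_eq_zero hk,
    if_neg hk1]
  simp

/-- Along the empty forest, the remainder of the integral is the sewing error plus the terms of
the germ with `|h| = N - 1`, which are of order `N α` only. -/
theorem remainder_integrationMap_one [Finite A] (hT : 0 < T) (a : A) {Z : Time T → CK A}
    (hZ : Z ∈ X.controlledPaths) (s t : Time T) :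
    X.remainder (X.integrationMap hT a Z) 1 s t =
      (X.roughIntegral hT a Z t - X.roughIntegral hT a Z s - X.toFun s t (CK.graft a (Z s))) +
        X.toFun s t (CK.graft a (topPart α (Z s))) := by
  classical
  rw [remainder, dualForest_one_integrationMap hT a hZ, integrationMap_eq hT a hZ, map_add,
    map_smul, convolution_apply_one, convolution_dualForest_one_graft, dualForest_one]
  simp only [if_true, smul_eq_mul, mul_one, map_sub, AlgHom.toLinearMap_apply]
  ring

/-- Along a tree `[h]_a`, the remainder of the integral is that of the integrand along `h`,
corrected by the components of the integrand of degree `N - 1`, which are not kept. -/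
theorem remainder_integrationMap_graft [Finite A] (hT : 0 < T) (a : A) {Z : Time T → CK A}
    (hZ : Z ∈ X.controlledPaths) {h : Forest A}
    (hh : h.degree + 1 < order α) (s t : Time T) :
    X.remainder (X.integrationMap hT a Z) (h.graft a) s t =
      X.remainder Z h s t +
        convolution (X.toFun s t).toLinearMap (dualForest h) (topPart α (Z s)) := by
  classical
  rw [remainder, dualForest_graft_integrationMap hT a hZ hh, integrationMap_eq hT a hZ, map_add,
    map_smul, convolution_apply_one, convolution_dualForest_graft, dualForest_one, map_sub,
    remainder, if_neg (fun e => one_notMem_range_graft a ⟨h, e⟩)]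
  simp only [smul_zero]
  ring

theorem remainder_integrationMap_eq_zero [Finite A] (hT : 0 < T) (a : A) {Z : Time T → CK A}
    (hZ : Z ∈ X.controlledPaths) {k : Forest A} (hk : k ∉ Set.range (Forest.graft a))
    (hk1 : k ≠ 1) (s t : Time T) :
    X.remainder (X.integrationMap hT a Z) k s t = 0 := by
  classical
  rw [remainder, dualForest_integrationMap_eq_zero hT a hZ hk hk1, integrationMap_eq hT a hZ,
    map_add, map_smul, convolution_apply_one, convolution_dualForest_graft_eq_zero _ hk hk1,
    dualForest_one, if_neg hk1]
  simp

/-- The constant of the sewing lemma for the exponent `θ = (N + 1) α`, per unit of defect. -/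
noncomputable def sewingConst (α : ℝ) : ℝ := 2 / (1 - 2 ^ (1 - ((order α : ℝ) + 1) * α)) + 1

theorem sewingConst_nonneg (hα₀ : 0 < α) : 0 ≤ sewingConst α := by
  have h := one_lt_order_add_one_mul hα₀
  have h2 : (2 : ℝ) ^ (1 - ((order α : ℝ) + 1) * α) < 1 :=
    Real.rpow_lt_one_of_one_lt_of_neg one_lt_two (by linarith)
  have : 0 < 1 - (2 : ℝ) ^ (1 - ((order α : ℝ) + 1) * α) := sub_pos.2 h2
  unfold sewingConst
  positivity

/-- The sewing lemma, applied to the germ `X_{s,t} [Z_s]_a`. -/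
theorem tendsto_riemannSum_and_abs_roughIntegral_sub_le [Finite A] (hα₀ : 0 < α) (hT : 0 < T)
    (a : A) {Z : Time T → CK A} (hZ : Z ∈ X.controlledPaths) :
    (∀ t, Tendsto (X.riemannSum a Z) (meshToZero (Time.zero hT) t) (𝓝 (X.roughIntegral hT a Z t))) ∧
    X.roughIntegral hT a Z (Time.zero hT) = 0 ∧
    ∀ s t : Time T,
      |X.roughIntegral hT a Z t - X.roughIntegral hT a Z s - X.toFun s t (CK.graft a (Z s))| ≤
        sewingConst α * (X.norm * X.controlledNorm hT Z) *
          |(t : ℝ) - s| ^ (((order α : ℝ) + 1) * α) := by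
  have hθ := one_lt_order_add_one_mul hα₀
  have hK : 0 ≤ X.norm * X.controlledNorm hT Z :=
    mul_nonneg X.norm_nonneg (controlledNorm_nonneg hT Z)
  obtain ⟨g, hg⟩ := exists_sewing (Ξ := fun s t : Time T => X.toFun s t (CK.graft a (Z s))) hθ hK
    (abs_germ_defect_le hα₀ hT hZ a)
  have key : ∀ t, Tendsto (X.riemannSum a Z) (meshToZero (Time.zero hT) t)
      (𝓝 (g t - g (Time.zero hT))) := by
    intro t
    have := tendsto_sum_of_abs_increment_sub_le hθ (mul_nonneg (sewingConst_nonneg hα₀) hK) hg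
        (Time.zero hT) t
    refine this.congr fun π => Finset.sum_congr rfl fun i _ => (sum_component_eq hZ a _ _).symm
  have hI : ∀ t, X.roughIntegral hT a Z t = g t - g (Time.zero hT) := fun t =>
    haveI := meshToZero_neBot (s := Time.zero hT) (t := t) t.2.1
    (key t).limUnder_eq
  refine ⟨fun t => hI t ▸ key t, by rw [hI, sub_self], fun s t => ?_⟩
  rw [hI, hI, sub_sub_sub_cancel_right]
  exact hg s t

/-- The sewing error, of order `(N + 1) α`, is of order `N α` at the price of a factor `T ^ α`. -/
theorem abs_remainder_integrationMap_one_le [Finite A] (hα₀ : 0 < α) (hT : 0 < T) (a : A)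
    {Z : Time T → CK A} (hZ : Z ∈ X.controlledPaths) (s t : Time T) :
    |X.remainder (X.integrationMap hT a Z) 1 s t| ≤
      (sewingConst α + 2 ^ order α) * (1 + T ^ α) * X.norm * X.controlledNorm hT Z *
        |(t : ℝ) - s| ^ ((order α : ℝ) * α) := by
  have hM := X.norm_nonneg
  have hZ0 := controlledNorm_nonneg (X := X) hT Z
  have hS := sewingConst_nonneg hα₀
  set d := |(t : ℝ) - s| with hd
  have hd0 : 0 ≤ d := abs_nonneg _
  have hTα : d ^ α ≤ T ^ α := Real.rpow_le_rpow hd0 (Time.abs_sub_le s t) hα₀.le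
  have hTα0 : 0 ≤ T ^ α := by positivity
  have e1 := (tendsto_riemannSum_and_abs_roughIntegral_sub_le hα₀ hT a hZ).2.2 s t
  have e2 := abs_apply_topPart_le hα₀ hT hZ ((X.toFun s t).toLinearMap ∘ₗ CK.graft a)
    (b := fun _ => X.norm * d ^ ((order α : ℝ) * α)) (fun g hg => by
      have := X.abs_component_le hα₀ (h := g.graft a) (by rw [Forest.degree_graft]; omega)
        (by rw [Forest.degree_graft]; omega) s t
      rw [Forest.degree_graft, hg] at this
      rw [LinearMap.comp_apply, CK.graft_ofForest]
      exact this) s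
  rw [← Finset.sum_mul] at e2
  have e3 := mul_le_mul_of_nonneg_right (sum_topBound_le (X := X) hT Z)
    (by positivity : 0 ≤ X.norm * d ^ ((order α : ℝ) * α))
  have e4 : d ^ (((order α : ℝ) + 1) * α) ≤ (1 + T ^ α) * d ^ ((order α : ℝ) * α) := by
    rw [add_mul, one_mul, Real.rpow_add_of_nonneg hd0 (by positivity) hα₀.le, mul_comm]
    refine mul_le_mul_of_nonneg_right (by linarith) (by positivity)
  have e5 := mul_le_mul_of_nonneg_left e4
    (by positivity : 0 ≤ sewingConst α * (X.norm * X.controlledNorm hT Z))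
  rw [remainder_integrationMap_one hT a hZ]
  refine (abs_add_le _ _).trans ((add_le_add (e1.trans e5) (e2.trans e3)).trans_eq ?_)
  ring

/-- The remainder of `Z` along `h` has `α` more in the exponent than is required of `[h]_a`, which
costs a factor `T ^ α`. In the other term, the pruned part has `N - 1 - |h| ≥ 1` nodes, so that a
component of `X` of this degree occurs. -/
theorem abs_remainder_integrationMap_graft_le [Finite A] (hα₀ : 0 < α) (hT : 0 < T) (a : A)
    {Z : Time T → CK A} (hZ : Z ∈ X.controlledPaths) {h : Forest A}
    (hh : h.degree + 1 < order α) (s t : Time T) :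
    |X.remainder (X.integrationMap hT a Z) (h.graft a) s t| ≤
      (holderNorm (((order α : ℝ) - h.degree) * α) (X.remainder Z h) * T ^ α +
        X.norm * ∑ g ∈ (forestsLT A (order α)).filter (fun g => ¬ g.degree + 1 < order α),
          X.topBound hT Z g * cutCount g h) *
        |(t : ℝ) - s| ^ (((order α : ℝ) - (h.graft a).degree) * α) := by
  set d := |(t : ℝ) - s| with hd
  have hd0 : 0 ≤ d := abs_nonneg _
  have hTα : d ^ α ≤ T ^ α := Real.rpow_le_rpow hd0 (Time.abs_sub_le s t) hα₀.le
  have hN : ((h.degree : ℝ) + 1) ≤ order α := by exact_mod_cast hh.le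
  have hγ : 0 ≤ ((order α : ℝ) - (h.degree + 1)) * α := mul_nonneg (by linarith) hα₀.le
  rw [remainder_integrationMap_graft hT a hZ hh, Forest.degree_graft, add_mul]
  push_cast
  refine (abs_add_le _ _).trans (add_le_add ?_ ?_)
  · refine (abs_remainder_le hα₀ hZ (by omega) s t).trans ?_
    rw [mul_assoc]
    refine mul_le_mul_of_nonneg_left ?_ (holderNorm_nonneg _ _)
    rw [show ((order α : ℝ) - h.degree) * α = α + ((order α : ℝ) - (h.degree + 1)) * α by ring,
      Real.rpow_add_of_nonneg hd0 hα₀.le hγ]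
    exact mul_le_mul_of_nonneg_right hTα (by positivity)
  · refine (abs_apply_topPart_le hα₀ hT hZ _ (b := fun g => cutCount g h *
      (X.norm * d ^ (((order α : ℝ) - (h.degree + 1)) * α))) (fun g hg => ?_) s).trans_eq ?_
    · refine abs_convolution_dualForest_le fun p hp => ?_
      have e : (p.degree : ℝ) = (order α : ℝ) - (h.degree + 1) := by
        rw [← hg, ← hp]; push_cast; ring
      rw [← e]
      exact X.abs_component_le hα₀ (by omega) (by omega) s t
    · rw [Finset.mul_sum, Finset.sum_mul]
      refine Finset.sum_congr rfl fun g _ => ?_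
      ring

theorem integrationMap_mem_controlledPaths [Finite A] (hα₀ : 0 < α) (hα₁ : α < 1) (hT : 0 < T)
    (a : A) {Z : Time T → CK A} (hZ : Z ∈ X.controlledPaths) :
    X.integrationMap hT a Z ∈ X.controlledPaths := by
  refine ⟨fun t => ?_, fun k hk => ?_⟩
  · refine Submodule.add_mem _ (Submodule.smul_mem _ _ (Submodule.subset_span ⟨1, ?_, rfl⟩))
      (Submodule.sum_mem _ fun h hh => Submodule.smul_mem _ _ (Submodule.subset_span ⟨_, ?_, rfl⟩))
    · exact one_le_order hα₀ hα₁
    · exact (Forest.degree_graft a h).trans_lt (Finset.mem_filter.1 hh).2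
  · by_cases hk1 : k = 1
    · subst hk1
      exact ⟨_, fun s t => by
        simpa [Forest.degree_one] using abs_remainder_integrationMap_one_le hα₀ hT a hZ s t⟩
    by_cases hkr : k ∈ Set.range (Forest.graft a)
    · obtain ⟨h, rfl⟩ := hkr
      rw [Forest.degree_graft] at hk
      exact ⟨_, abs_remainder_integrationMap_graft_le hα₀ hT a hZ hk⟩
    · exact ⟨0, fun s t => by simp [remainder_integrationMap_eq_zero hT a hZ hkr hk1]⟩

/-- The sum over the trees `[h]_a` is finite uniformly in the labels since the cut counts of each
`g` of degree `N - 1` sum over `h` to at most `2 ^ N`; together with `sum_topBound_le` this gives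
the term `4 ^ N`. -/
theorem controlledNorm_integrationMap_le [Finite A] (hα₀ : 0 < α) (hT : 0 < T) (a : A)
    {Z : Time T → CK A} (hZ : Z ∈ X.controlledPaths) :
    X.controlledNorm hT (X.integrationMap hT a Z) ≤
      (sewingConst α + 2 ^ order α + 1 + 4 ^ order α) * (1 + T ^ α) * (1 + X.norm) *
        X.controlledNorm hT Z := by
  classical
  have hM := X.norm_nonneg
  have hZ0 := controlledNorm_nonneg (X := X) hT Z
  have hS := sewingConst_nonneg hα₀
  have hTα0 : 0 ≤ T ^ α := by positivity
  set C₁ := (sewingConst α + 2 ^ order α) * (1 + T ^ α) * X.norm * X.controlledNorm hT Z with hC₁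
  set r : Forest A → ℝ := fun h => holderNorm (((order α : ℝ) - h.degree) * α) (X.remainder Z h)
  set top := (forestsLT A (order α)).filter (fun g => ¬ g.degree + 1 < order α) with htop
  set G : Forest A → ℝ := fun h => r h * T ^ α + X.norm *
    ∑ g ∈ top, X.topBound hT Z g * cutCount g h with hG
  set F : Forest A → ℝ := fun h => |dualForest h (Z (Time.zero hT))| + G h with hF
  have hC₁0 : 0 ≤ C₁ := by positivity
  have hG0 : ∀ h, 0 ≤ G h := fun h => add_nonneg (mul_nonneg (holderNorm_nonneg _ _) hTα0)
    (mul_nonneg hM (Finset.sum_nonneg fun g _ =>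
      mul_nonneg (topBound_nonneg hT Z g) (cutCount_nonneg g h)))
  have hF0 : ∀ h, 0 ≤ F h := fun h => add_nonneg (abs_nonneg _) (hG0 h)
  -- the forests that carry a nonzero term are `1` and the trees `[h]_a`
  have term : ∀ k ∈ forestsLT A (order α),
      |dualForest k (X.integrationMap hT a Z (Time.zero hT))| +
        holderNorm (((order α : ℝ) - k.degree) * α) (X.remainder (X.integrationMap hT a Z) k) ≤
      (if k = 1 then C₁ else 0) + ∑ h ∈ forestsLT A (order α),
        if k = h.graft a then F h else 0 := by
    intro k hk
    have hk' := mem_forestsLT.1 hk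
    have hsum0 : ∀ h ∈ forestsLT A (order α), 0 ≤ if k = h.graft a then F h else 0 := fun h _ => by
      split_ifs
      exacts [hF0 h, le_rfl]
    by_cases hk1 : k = 1
    · subst hk1
      rw [if_pos rfl, dualForest_one_integrationMap hT a hZ,
        (tendsto_riemannSum_and_abs_roughIntegral_sub_le hα₀ hT a hZ).2.1, abs_zero, zero_add]
      refine le_add_of_le_of_nonneg (holderNorm_le hC₁0 fun s t => ?_) (Finset.sum_nonneg hsum0)
      simpa [Forest.degree_one] using abs_remainder_integrationMap_one_le hα₀ hT a hZ s t
    rw [if_neg hk1, zero_add]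
    by_cases hkr : k ∈ Set.range (Forest.graft a)
    · obtain ⟨h, rfl⟩ := hkr
      rw [Forest.degree_graft] at hk'
      refine le_trans ?_ (Finset.single_le_sum hsum0
          (mem_forestsLT.2 (by omega : h.degree < order α)))
      rw [if_pos rfl, dualForest_graft_integrationMap hT a hZ hk']
      refine add_le_add le_rfl (holderNorm_le (hG0 h) ?_)
      exact abs_remainder_integrationMap_graft_le hα₀ hT a hZ hk'
    · refine le_trans ?_ (Finset.sum_nonneg hsum0)
      rw [dualForest_integrationMap_eq_zero hT a hZ hkr hk1, abs_zero, zero_add]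
      exact holderNorm_le le_rfl fun s t => by
        simp [remainder_integrationMap_eq_zero hT a hZ hkr hk1]
  have sumF : ∑ h ∈ forestsLT A (order α), F h ≤
      X.controlledNorm hT Z * (1 + T ^ α) +
        X.norm * (4 ^ order α * (1 + T ^ α) * X.controlledNorm hT Z) := by
    have i1 : ∑ h ∈ forestsLT A (order α), ∑ g ∈ top, X.topBound hT Z g * cutCount g h ≤
        4 ^ order α * (1 + T ^ α) * X.controlledNorm hT Z := by
      rw [Finset.sum_comm]
      calc ∑ g ∈ top, ∑ h ∈ forestsLT A (order α), X.topBound hT Z g * cutCount g h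
          ≤ ∑ g ∈ top, X.topBound hT Z g * 2 ^ order α := by
            refine Finset.sum_le_sum fun g hg => ?_
            rw [← Finset.mul_sum]
            refine mul_le_mul_of_nonneg_left ((sum_cutCount_le _ _).trans ?_)
                (topBound_nonneg hT Z g)
            exact pow_le_pow_right₀ one_le_two
              (mem_forestsLT.1 (Finset.mem_filter.1 hg).1).le
        _ ≤ 2 ^ order α * (1 + T ^ α) * X.controlledNorm hT Z * 2 ^ order α := by
            rw [← Finset.sum_mul]
            exact mul_le_mul_of_nonneg_right (sum_topBound_le hT Z) (by positivity)
        _ = _ := by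
            rw [show (4 : ℝ) = 2 * 2 by norm_num, mul_pow]
            ring
    have i2 := sum_abs_le_controlledNorm (X := X) hT Z
    have i3 := mul_le_mul_of_nonneg_right (sum_holderNorm_le_controlledNorm (X := X) hT Z) hTα0
    have i4 := mul_le_mul_of_nonneg_left i1 hM
    simp only [hF, hG, Finset.sum_add_distrib, ← Finset.sum_mul, ← Finset.mul_sum]
    linarith
  calc X.controlledNorm hT (X.integrationMap hT a Z)
      ≤ ∑ k ∈ forestsLT A (order α), ((if k = 1 then C₁ else 0) +
          ∑ h ∈ forestsLT A (order α), if k = h.graft a then F h else 0) :=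
        Finset.sum_le_sum term
    _ ≤ C₁ + ∑ h ∈ forestsLT A (order α), F h := by
        rw [Finset.sum_add_distrib, Finset.sum_comm]
        refine add_le_add ?_ (Finset.sum_le_sum fun h _ => ?_)
        · rw [Finset.sum_ite_eq']
          split_ifs
          exacts [le_rfl, hC₁0]
        · rw [Finset.sum_ite_eq']
          split_ifs
          exacts [le_rfl, hF0 h]
    _ ≤ _ := by
        refine (add_le_add le_rfl sumF).trans ?_
        rw [hC₁]
        have j1 : 0 ≤ (sewingConst α + 2 ^ order α) *
            ((1 + T ^ α) * X.controlledNorm hT Z) := by positivity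
        have j2 : 0 ≤ X.norm * ((1 + T ^ α) * X.controlledNorm hT Z) := by positivity
        have j3 : 0 ≤ 4 ^ order α * ((1 + T ^ α) * X.controlledNorm hT Z) := by positivity
        linarith

end BranchedRoughPath

end Integration

end BranchedRP

theorem mainTheorem6 (α : ℝ) (hα₀ : 0 < α) (hα₁ : α < 1)
    (hα : ∀ n : ℕ, 1 ≤ n → α ≠ 1 / (n : ℝ)) :
    ∃ C : ℝ, ∀ (A : Type*) [Finite A] (T : ℝ) (hT : 0 < T)
      (X : BranchedRP.BranchedRoughPath A α T) (a : A),
      ∀ Z ∈ X.controlledPaths,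
        (∀ t : BranchedRP.Time T,
          Filter.Tendsto (X.riemannSum a Z)
            (BranchedRP.meshToZero (BranchedRP.Time.zero hT) t)
            (nhds (X.roughIntegral hT a Z t))) ∧
        X.integrationMap hT a Z ∈ X.controlledPaths ∧
        X.controlledNorm hT (X.integrationMap hT a Z) ≤
          C * (1 + T ^ α) * (1 + X.norm) * X.controlledNorm hT Z :=
  ⟨_, fun _ _ _ hT _ a _ hZ =>
    ⟨(BranchedRP.BranchedRoughPath.tendsto_riemannSum_and_abs_roughIntegral_sub_le hα₀ hT a hZ).1,
      BranchedRP.BranchedRoughPath.integrationMap_mem_controlledPaths hα₀ hα₁ hT a hZ,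
      BranchedRP.BranchedRoughPath.controlledNorm_integrationMap_le hα₀ hT a hZ⟩⟩
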